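/- Let $m\ge 3$ and $n$ be natural numbers. For $d\in\mathbb N$ let $\Phi_d(x,t)=(4\pi t)^{-d/2}e^{-|x|^2/4t}$ ($x\in\mathbb R^d$, $t>0$) be the heat kernel, and let $H=\Delta_x-\partial_t$ be the heat operator on $\mathbb R^n\times\mathbb R$. For $(x,t)\in\mathbb R^n\times\mathbb R$ and $R>0$ let $$E_m(x,t;R)=\{(x,t)\}\cup\{(y,s)\in\mathbb R^n\times\mathbb R: s<t,\ \Phi_{m+n}((0,x-y),t-s)\ge R^{-(m+n)}\}$$ be the modified heatball, i.e. the projection to $\mathbb R^n\times\mathbb R$ of the heatball $\{((0,x),t)\}\cup\{((\eta,y),s): s<t,\ \Phi_{m+n}((-\eta,x-y),t-s)\ge R^{-(m+n)}\}$ of $\mathbb R^{m+n}\times\mathbb R$. Put $$\kappa_{m,n}(y,s)=\frac14\int_{\{\eta\in\mathbb R^m:\ \Phi_{m+n}((\eta,y),s)\ge 1\}}\frac{|\eta|^2+|y|^2}{s^2}\,d\eta ,$$ $$M_{m,n}=|B_1|\,\frac{2\pi}{e}\left(\frac{2(m+n)(m+2)}{4\pi e\,(m-2)}\right)^{m/2}\frac{m(m+n)}{m-2},$$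 where $|B_1|$ is the volume of the unit ball of $\mathbb R^m$. Then: (i) $M_{m,n}$ is the maximum of $\kappa_{m,n}$ over $\{(y,s)\in\mathbb R^n\times(0,\infty):\Phi_{m+n}((0,y),s)\ge 1\}$. (ii) Let $\Omega\subseteq\mathbb R^n\times\mathbb R$ be open and let $u:\Omega\to\mathbb R$ be a $C^2$ function with $Hu\ge 0$ on $\Omega$. Write $u_+=\max(u,0)$. Whenever $R>0$ and $E_m(x,t;R)\subseteq\Omega$, the function $u_+$ is integrable on $E_m(x,t;R)$ and $$u_+(x,t)\le\frac{M_{m,n}}{R^{n+2}}\int_{E_m(x,t;R)}u_+(y,s)\,dy\,ds .$$ -/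

import Mathlib

open MeasureTheory Laplacian

noncomputable section

namespace HeatMean

/-- The heat kernel `Φ_d(x,t) = (4πt)^{-d/2} exp(-|x|²/(4t))` on `ℝ^ι × ℝ`, where `d = #ι`
(meaningful for `t > 0`). -/
def heatKernel {ι : Type*} [Fintype ι] (x : EuclideanSpace ℝ ι) (t : ℝ) : ℝ :=
  1 / (4 * Real.pi * t) ^ ((Fintype.card ι : ℝ) / 2) * Real.exp (-‖x‖ ^ 2 / (4 * t))

/-- The heatball `E(x,t;r)`: the centre `(x,t)` together with the points `(y,s)`, `s < t`, with
`Φ_d(x-y,t-s) ≥ 1/r^d`. -/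
def heatBall {ι : Type*} [Fintype ι] (x : EuclideanSpace ℝ ι) (t r : ℝ) :
    Set (EuclideanSpace ℝ ι × ℝ) :=
  {(x, t)} ∪ {p | p.2 < t ∧ 1 / r ^ Fintype.card ι ≤ heatKernel (x - p.1) (t - p.2)}

/-- The point `(η, y)` of `ℝ^m × ℝ^n = ℝ^{m+n}`. -/
def pair {m n : ℕ} (η : EuclideanSpace ℝ (Fin m)) (y : EuclideanSpace ℝ (Fin n)) :
    EuclideanSpace ℝ (Fin m ⊕ Fin n) :=
  WithLp.toLp 2 (Sum.elim η y)

/-- The modified heatball `E_m(x,t;r)`: the projection of the heatball `E((0,x),t;r)` of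
`ℝ^{m+n} × ℝ` along the first `m` coordinates. -/
def modHeatBall (m : ℕ) {n : ℕ} (x : EuclideanSpace ℝ (Fin n)) (t r : ℝ) :
    Set (EuclideanSpace ℝ (Fin n) × ℝ) :=
  {p | ∃ η : EuclideanSpace ℝ (Fin m), (pair η p.1, p.2) ∈ heatBall (pair 0 x) t r}

/-- The heat operator `H = Δ_x - ∂_t`. -/
def heatOp {n : ℕ} (u : EuclideanSpace ℝ (Fin n) × ℝ → ℝ) (p : EuclideanSpace ℝ (Fin n) × ℝ) : ℝ :=
  Δ (fun y => u (y, p.2)) p.1 - deriv (fun s => u (p.1, s)) p.2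

/-- The kernel `κ_{m,n}(y,s)`: the kernel `(|η|² + |y|²)/(4s²)` of the averages over the unit
heatball of `ℝ^{m+n} × ℝ`, with the `m` extra spatial variables `η` integrated out. -/
def modKernel (m n : ℕ) (y : EuclideanSpace ℝ (Fin n)) (s : ℝ) : ℝ :=
  1 / 4 * ∫ η in {η : EuclideanSpace ℝ (Fin m) | 1 ≤ heatKernel (pair η y) s},
    (‖η‖ ^ 2 + ‖y‖ ^ 2) / s ^ 2

/-- The constant `M_{m,n}`; `|B₁|` is the volume of the unit ball of `ℝ^m`. -/
def modConst (m n : ℕ) : ℝ :=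
  volume.real (Metric.ball (0 : EuclideanSpace ℝ (Fin m)) 1) * (2 * Real.pi / Real.exp 1) *
    (2 * ((m : ℝ) + n) * ((m : ℝ) + 2) / (4 * Real.pi * Real.exp 1 * ((m : ℝ) - 2))) ^
      ((m : ℝ) / 2) *
    ((m : ℝ) * ((m : ℝ) + n) / ((m : ℝ) - 2))

end HeatMean

end

namespace HeatMean

/-! Translate the centre to the origin and reverse time, writing `τ = t - s`, `N = m + n`, `z = (η,
y)` and `v` for the reversed `u`, so that `Δv + ∂_τ v ≥ 0`. Let `ψ = log (R^N Φ_N(z, τ))`, which is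
`heatExponent`; the heatball away from its centre is `ψ ≥ 0`. For a profile `g` vanishing on `(-∞,
0]` put `F(τ) = ∫ g(ψ) v dz` over `ℝ^m × ℝ^n`, with `v` constant in `η`. Since `|∇ψ|² = |z|²/(4τ²)`,
`Δψ = -N/(2τ)` and `∂_τ ψ` is the sum of these two, Green's formula gives `-F'(τ) ≤ ∫ (g'' - g')(ψ)
|z|²/(4τ²) v dz`. If `0 ≤ g'' - g' ≤ 1`, the weight is nonnegative, so `v` may be replaced by `v₊`;
integrating out `η` then leaves at most the kernel `scaledKernel`, bounded by `modConst m n * R ^ (m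
- 2)`. At the top `τ = R²/(4π)` of the heatball `g(ψ)` vanishes, so `F = 0`. As `τ → 0`, if `g(s) ~
A e^s`, then `g(ψ)` behaves like `A R^N Φ_N` and `F → A R^N v(0)`. Integrating `-F'` bounds `A R^N
v(0)` by `M R^(m-2)` times the integral of `v₊`. The choice `g = e^s - 1 - s` would give `g'' - g' =
1` and `A = 1`, but it is not `C²` at `0`. Solving `g'' - g' = 1 - e^(-ks)` instead gives a `C²`
profile with `A = k/(k+1)`, and `k → ∞` finishes. The maximum of the kernel is explicit: Bernoulli's
inequality reduces it to the axis `y = 0`, and there it is a power of `x e^(1-x) ≤ 1`, with equality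
at `x = 1`. -/

/-- The logarithm of `R ^ (m + n) * Φ_{m+n}(z, τ)`, where `q = |z|²`. -/
noncomputable def heatExponent (m n : ℕ) (R q τ : ℝ) : ℝ :=
  ((m : ℝ) + n) / 2 * Real.log (R ^ 2 / (4 * Real.pi * τ)) - q / (4 * τ)

/-! ### Heatballs in logarithmic form. -/

theorem norm_sq_pair {m n : ℕ} (η : EuclideanSpace ℝ (Fin m)) (y : EuclideanSpace ℝ (Fin n)) :
    ‖pair η y‖ ^ 2 = ‖η‖ ^ 2 + ‖y‖ ^ 2 := by
  simp [EuclideanSpace.norm_sq_eq, pair]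

theorem pow_mul_heatKernel_pair {m n : ℕ} (η : EuclideanSpace ℝ (Fin m))
    (y : EuclideanSpace ℝ (Fin n)) {R τ : ℝ} (hR : 0 < R) (hτ : 0 < τ) :
    R ^ (m + n) * heatKernel (pair η y) τ =
      Real.exp (heatExponent m n R (‖η‖ ^ 2 + ‖y‖ ^ 2) τ) := by
  have hp : 0 < 4 * Real.pi * τ := by positivity
  rw [heatKernel, norm_sq_pair, heatExponent, Real.log_div (by positivity) hp.ne', Real.log_pow,
    Real.rpow_def_of_pos hp, ← Real.rpow_natCast R, Real.rpow_def_of_pos hR, one_div,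
    ← Real.exp_neg, ← Real.exp_add, ← Real.exp_add]
  congr 1
  simp
  ring

theorem le_heatKernel_pair_iff {m n : ℕ} (η : EuclideanSpace ℝ (Fin m))
    (y : EuclideanSpace ℝ (Fin n)) {R τ : ℝ} (hR : 0 < R) (hτ : 0 < τ) :
    1 / R ^ (m + n) ≤ heatKernel (pair η y) τ ↔
      0 ≤ heatExponent m n R (‖η‖ ^ 2 + ‖y‖ ^ 2) τ := by
  rw [div_le_iff₀' (by positivity), pow_mul_heatKernel_pair η y hR hτ, Real.one_le_exp_iff]

theorem heatExponent_nonneg_iff {m n : ℕ} {R q τ : ℝ} (hτ : 0 < τ) :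
    0 ≤ heatExponent m n R q τ ↔
      q ≤ 2 * ((m : ℝ) + n) * τ * Real.log (R ^ 2 / (4 * Real.pi * τ)) := by
  rw [heatExponent, sub_nonneg, div_le_iff₀ (by positivity)]
  ring_nf

/-! ### The integrated kernel and its maximum. -/

/-- The scaled kernel: the kernel of the averages over the heatball of radius `R`, with the `m`
extra spatial variables integrated out. -/
noncomputable def scaledKernel (m n : ℕ) (R : ℝ) (y : EuclideanSpace ℝ (Fin n)) (τ : ℝ) : ℝ :=
  1 / 4 * ∫ η in {η : EuclideanSpace ℝ (Fin m) | 0 ≤ heatExponent m n R (‖η‖ ^ 2 + ‖y‖ ^ 2) τ},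
    (‖η‖ ^ 2 + ‖y‖ ^ 2) / τ ^ 2

theorem modKernel_eq_scaledKernel (m n : ℕ) (y : EuclideanSpace ℝ (Fin n)) {τ : ℝ} (hτ : 0 < τ) :
    modKernel m n y τ = scaledKernel m n 1 y τ := by
  have h (η : EuclideanSpace ℝ (Fin m)) := le_heatKernel_pair_iff η y one_pos hτ
  simp only [one_pow, div_one] at h
  simp only [modKernel, scaledKernel, h]

/-- Polar coordinates: the sphere of radius `s` has area `m |B₁| s^(m-1)`. -/
theorem integral_closedBall_norm_sq_add {m : ℕ} (hm : 0 < m) {r : ℝ} (hr : 0 ≤ r) (a : ℝ) :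
    ∫ η in Metric.closedBall (0 : EuclideanSpace ℝ (Fin m)) r, (‖η‖ ^ 2 + a) =
      volume.real (Metric.ball (0 : EuclideanSpace ℝ (Fin m)) 1) *
        ((m : ℝ) / (m + 2) * r ^ (m + 2) + a * r ^ m) := by
  have : Nontrivial (EuclideanSpace ℝ (Fin m)) := by
    have : NeZero m := ⟨hm.ne'⟩
    infer_instance
  rw [← integral_indicator Metric.isClosed_closedBall.measurableSet]
  have h1 : (Metric.closedBall (0 : EuclideanSpace ℝ (Fin m)) r).indicator
      (fun η => ‖η‖ ^ 2 + a) = fun η => (Set.Iic r).indicator (fun s => s ^ 2 + a) ‖η‖ := by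
    ext η
    simp [Set.indicator]
  rw [h1, integral_fun_norm_addHaar]
  have h2 : ∫ y in Set.Ioi (0 : ℝ), y ^ (Module.finrank ℝ (EuclideanSpace ℝ (Fin m)) - 1) •
      (Set.Iic r).indicator (fun s => s ^ 2 + a) y =
      ∫ y in (0 : ℝ)..r, (y ^ (m + 1) + a * y ^ (m - 1)) := by
    rw [intervalIntegral.integral_of_le hr, ← Set.Ioi_inter_Iic,
      ← setIntegral_indicator measurableSet_Iic]
    refine integral_congr_ae (Filter.Eventually.of_forall fun y => ?_)
    by_cases hy : y ∈ Set.Iic r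
    · simp only [Set.indicator_of_mem hy, finrank_euclideanSpace, Fintype.card_fin, smul_eq_mul]
      -- Writing `m` as a successor removes the truncated subtraction in `m - 1`.
      obtain ⟨k, rfl⟩ := Nat.exists_eq_add_of_lt hm
      simp
      ring
    · simp [Set.indicator_of_notMem hy]
  have hm' : (m : ℝ) ≠ 0 := by positivity
  rw [h2, intervalIntegral.integral_add
      (Continuous.intervalIntegrable (by fun_prop) _ _)
      (Continuous.intervalIntegrable (by fun_prop) _ _),
    intervalIntegral.integral_const_mul, integral_pow, integral_pow]
  obtain ⟨k, rfl⟩ := Nat.exists_eq_add_of_lt hm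
  simp only [finrank_euclideanSpace, Fintype.card_fin, nsmul_eq_mul, smul_eq_mul]
  simp
  field_simp
  ring

/-- The admissible `η` form a ball of radius `√(ρ - |y|²)`, on which the integrand is a radial
quadratic. -/
theorem scaledKernel_eq {m n : ℕ} (hm : 0 < m) {R τ ρ : ℝ} (y : EuclideanSpace ℝ (Fin n))
    (hτ : 0 < τ) (hy : ‖y‖ ^ 2 ≤ ρ)
    (hρ : ρ = 2 * ((m : ℝ) + n) * τ * Real.log (R ^ 2 / (4 * Real.pi * τ))) :
    scaledKernel m n R y τ = volume.real (Metric.ball (0 : EuclideanSpace ℝ (Fin m)) 1) / 4 *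
      ((m : ℝ) / (m + 2) * √(ρ - ‖y‖ ^ 2) ^ (m + 2) + ‖y‖ ^ 2 * √(ρ - ‖y‖ ^ 2) ^ m) / τ ^ 2 := by
  have h1 : {η : EuclideanSpace ℝ (Fin m) | 0 ≤ heatExponent m n R (‖η‖ ^ 2 + ‖y‖ ^ 2) τ} =
      Metric.closedBall 0 √(ρ - ‖y‖ ^ 2) := by
    ext η
    rw [Set.mem_ofPred_eq, heatExponent_nonneg_iff hτ, ← hρ, mem_closedBall_zero_iff,
      Real.le_sqrt (norm_nonneg _) (by linarith)]
    constructor <;> intro h <;> linarith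
  rw [scaledKernel, h1, integral_div, integral_closedBall_norm_sq_add hm (Real.sqrt_nonneg _)]
  ring

/-- For fixed `τ` the kernel is largest on the axis. With `b = ρ - a`, Bernoulli's inequality for
`(1 + a/b)^(m/2+1)` bounds the right side below by the same leading term plus `(m/2) a b^(m/2)`, and
`m/2 ≥ 1`. -/
theorem radial_moment_le {m : ℕ} (hm : 2 ≤ m) {ρ a : ℝ} (ha : 0 ≤ a) (haρ : a ≤ ρ) :
    (m : ℝ) / (m + 2) * √(ρ - a) ^ (m + 2) + a * √(ρ - a) ^ m ≤
      (m : ℝ) / (m + 2) * ρ ^ ((m : ℝ) / 2 + 1) := by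
  have hm' : (2 : ℝ) ≤ m := by exact_mod_cast hm
  rcases haρ.eq_or_lt with rfl | h
  · have : 0 ≤ (m : ℝ) / (m + 2) * a ^ ((m : ℝ) / 2 + 1) := by positivity
    simpa [show m ≠ 0 by omega] using this
  set b := ρ - a with hb
  have hb0 : 0 < b := by linarith
  have e1 : √b ^ m = b ^ ((m : ℝ) / 2) := by
    rw [Real.sqrt_eq_rpow, ← Real.rpow_natCast, ← Real.rpow_mul hb0.le]
    congr 1; ring
  have e2 : √b ^ (m + 2) = b ^ ((m : ℝ) / 2) * b := by
    rw [pow_add, e1, Real.sq_sqrt hb0.le]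
  have e3 : ρ ^ ((m : ℝ) / 2 + 1) = b ^ ((m : ℝ) / 2) * b * (1 + a / b) ^ ((m : ℝ) / 2 + 1) := by
    rw [show ρ = b * (1 + a / b) by field_simp; linarith,
      Real.mul_rpow hb0.le (by positivity), Real.rpow_add_one hb0.ne']
  have h1 := one_add_mul_self_le_rpow_one_add (s := a / b) (by
    have : 0 ≤ a / b := by positivity
    linarith) (p := (m : ℝ) / 2 + 1) (by linarith)
  rw [e1, e2, e3]
  have hpos : 0 < b ^ ((m : ℝ) / 2) := by positivity
  have h2 : (m : ℝ) / (m + 2) * (b ^ ((m : ℝ) / 2) * b * (1 + ((m : ℝ) / 2 + 1) * (a / b))) ≤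
      (m : ℝ) / (m + 2) * (b ^ ((m : ℝ) / 2) * b * (1 + a / b) ^ ((m : ℝ) / 2 + 1)) := by
    gcongr
  refine le_trans ?_ h2
  have h3 : (m : ℝ) / (m + 2) * (b ^ ((m : ℝ) / 2) * b * (1 + ((m : ℝ) / 2 + 1) * (a / b))) =
      (m : ℝ) / (m + 2) * (b ^ ((m : ℝ) / 2) * b) + m / 2 * (a * b ^ ((m : ℝ) / 2)) := by
    field_simp
  rw [h3]
  have : 0 ≤ a * b ^ ((m : ℝ) / 2) := by positivity
  nlinarith

/-- The values of the kernel on the axis `y = 0`, normalised by their maximum. -/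
theorem axis_kernel_eq {m n : ℕ} (hm : 3 ≤ m) {R τ L x : ℝ} (hR : 0 < R) (hτ : 0 < τ)
    (hL : L = Real.log (R ^ 2 / (4 * Real.pi * τ))) (hL0 : 0 ≤ L)
    (hx : x = L * ((m : ℝ) - 2) / (m + 2)) :
    volume.real (Metric.ball (0 : EuclideanSpace ℝ (Fin m)) 1) / 4 *
      ((m : ℝ) / (m + 2) * (2 * ((m : ℝ) + n) * τ * L) ^ ((m : ℝ) / 2 + 1)) / τ ^ 2 =
      modConst m n * R ^ (m - 2) * (x * Real.exp (1 - x)) ^ ((m : ℝ) / 2 + 1) := by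
  have hm' : (3 : ℝ) ≤ m := by exact_mod_cast hm
  have hm2 : (0 : ℝ) < m - 2 := by linarith
  set c := R ^ 2 / (4 * Real.pi) with hc
  have hc0 : 0 < c := by positivity
  have hτL : τ = c * Real.exp (-L) := by
    rw [hL, Real.exp_neg, Real.exp_log (by positivity), hc]
    field_simp
  have hx0 : 0 ≤ x := by rw [hx]; positivity
  set Q := 2 * ((m : ℝ) + n) * ((m : ℝ) + 2) / (4 * Real.pi * Real.exp 1 * ((m : ℝ) - 2)) with hQ
  have hQ0 : 0 < Q := by positivity
  have hZ : 2 * ((m : ℝ) + n) * τ * L =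
      (x * Real.exp (1 - x)) * (Q * R ^ 2) * Real.exp (x - L) := by
    rw [hτL, hQ, Real.exp_sub, Real.exp_sub, hc, hx, Real.exp_neg]
    field_simp
  -- Since `x - L = -4L/(m+2)`, this power is exactly the exponential factor of `τ²`, so the two
  -- cancel and `L` survives only through `x`.
  have hexp : Real.exp (x - L) ^ ((m : ℝ) / 2 + 1) = Real.exp (-(2 * L)) := by
    rw [← Real.exp_mul, hx]
    congr 1
    field_simp
    ring
  have hQR : (Q * R ^ 2) ^ ((m : ℝ) / 2 + 1) = Q ^ ((m : ℝ) / 2) * Q * R ^ (m - 2) * R ^ 4 := by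
    rw [Real.mul_rpow hQ0.le (by positivity), Real.rpow_add_one hQ0.ne',
      ← Real.rpow_natCast R 2, ← Real.rpow_mul hR.le, mul_assoc _ (R ^ (m - 2)), ← pow_add,
      ← Real.rpow_natCast R (m - 2 + 4)]
    congr 2
    rw [show m - 2 + 4 = m + 2 by omega]
    push_cast
    ring
  have hτ2 : τ ^ 2 = c ^ 2 * Real.exp (-(2 * L)) := by
    rw [hτL, mul_pow, ← Real.exp_nat_mul]
    congr 2
    push_cast
    ring
  rw [hZ, Real.mul_rpow (by positivity) (by positivity), Real.mul_rpow (by positivity)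
    (by positivity), hexp, hQR, hτ2, modConst, ← hQ]
  have e0 := (Real.exp_pos (-(2 * L))).ne'
  have hQ1 : Q * (m - 2) * Real.exp 1 * (2 * Real.pi) = ((m : ℝ) + n) * (m + 2) := by
    rw [hQ]; field_simp; ring
  have hc2 : c ^ 2 * (16 * Real.pi ^ 2) = R ^ 4 := by
    rw [hc]; field_simp; ring
  rw [← hc2]
  clear_value c Q
  generalize (x * Real.exp (1 - x)) ^ ((m : ℝ) / 2 + 1) = X
  generalize Q ^ ((m : ℝ) / 2) = Y
  generalize volume.real (Metric.ball (0 : EuclideanSpace ℝ (Fin m)) 1) = V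
  generalize R ^ (m - 2) = W
  field_simp
  linear_combination (8 * V * X * Y * W) * hQ1

theorem mul_exp_one_sub_le_one (x : ℝ) : x * Real.exp (1 - x) ≤ 1 := by
  have h := Real.add_one_le_exp (x - 1)
  have h2 : Real.exp (x - 1) * Real.exp (1 - x) = 1 := by
    rw [← Real.exp_add]; simp
  nlinarith [Real.exp_pos (1 - x)]

theorem modConst_nonneg {m n : ℕ} (hm : 3 ≤ m) : 0 ≤ modConst m n := by
  have hm' : (3 : ℝ) ≤ m := by exact_mod_cast hm
  have hm2 : (0 : ℝ) < m - 2 := by linarith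
  unfold modConst
  positivity

/-- Compare with the axis, then use `x e^(1-x) ≤ 1`. The factor `R ^ (m - 2)` is parabolic scaling:
`m` integrations and two powers of length, divided by `τ²`. -/
theorem scaledKernel_le {m n : ℕ} (hm : 3 ≤ m) {R τ : ℝ} (hR : 0 < R) (hτ : 0 < τ)
    (y : EuclideanSpace ℝ (Fin n)) (h : 0 ≤ heatExponent m n R (‖y‖ ^ 2) τ) :
    scaledKernel m n R y τ ≤ modConst m n * R ^ (m - 2) := by
  have hm' : (3 : ℝ) ≤ m := by exact_mod_cast hm
  have hm2 : (0 : ℝ) < m - 2 := by linarith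
  rw [heatExponent_nonneg_iff hτ] at h
  set L := Real.log (R ^ 2 / (4 * Real.pi * τ)) with hL
  have hL0 : 0 ≤ L := by
    have h0 : 0 ≤ 2 * ((m : ℝ) + n) * τ * L := le_trans (by positivity) h
    exact nonneg_of_mul_nonneg_right h0 (by positivity)
  rw [scaledKernel_eq (by omega) y hτ h (by rw [hL])]
  have key := axis_kernel_eq (n := n) hm hR hτ hL hL0 rfl
  calc _ ≤ volume.real (Metric.ball (0 : EuclideanSpace ℝ (Fin m)) 1) / 4 *
      ((m : ℝ) / (m + 2) * (2 * ((m : ℝ) + n) * τ * L) ^ ((m : ℝ) / 2 + 1)) / τ ^ 2 := by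
        gcongr
        exact radial_moment_le (by omega) (by positivity) h
    _ ≤ _ := by
      rw [key]
      refine mul_le_of_le_one_right (mul_nonneg (modConst_nonneg hm) (by positivity)) ?_
      exact Real.rpow_le_one (mul_nonneg (by positivity) (Real.exp_pos _).le)
        (mul_exp_one_sub_le_one _) (by positivity)

theorem isGreatest_modKernel {m n : ℕ} (hm : 3 ≤ m) :
    IsGreatest
      {k : ℝ | ∃ (y : EuclideanSpace ℝ (Fin n)) (s : ℝ), 0 < s ∧
        1 ≤ heatKernel (pair (0 : EuclideanSpace ℝ (Fin m)) y) s ∧ k = modKernel m n y s}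
      (modConst m n) := by
  have hiff (y : EuclideanSpace ℝ (Fin n)) {s : ℝ} (hs : 0 < s) :
      1 ≤ heatKernel (pair (0 : EuclideanSpace ℝ (Fin m)) y) s ↔
        0 ≤ heatExponent m n 1 (‖y‖ ^ 2) s := by
    simpa using le_heatKernel_pair_iff (0 : EuclideanSpace ℝ (Fin m)) y one_pos hs
  constructor
  · have hm' : (3 : ℝ) ≤ m := by exact_mod_cast hm
    have hm2 : (0 : ℝ) < m - 2 := by linarith
    -- Chosen so that the normalised variable `x = L (m-2)/(m+2)` equals `1`, where `x e^(1-x)`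
    -- attains its maximum.
    set L : ℝ := ((m : ℝ) + 2) / (m - 2) with hL
    have hL0 : 0 ≤ L := by positivity
    set τ : ℝ := Real.exp (-L) / (4 * Real.pi) with hτ
    have hτ0 : 0 < τ := by positivity
    have hLτ : L = Real.log (1 ^ 2 / (4 * Real.pi * τ)) := by
      rw [hτ, mul_div_cancel₀ _ (by positivity), one_pow, one_div, ← Real.exp_neg, Real.log_exp,
        neg_neg]
    have h0 : ‖(0 : EuclideanSpace ℝ (Fin n))‖ ^ 2 ≤ 2 * ((m : ℝ) + n) * τ * L := by
      simp; positivity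
    refine ⟨0, τ, hτ0, ?_, ?_⟩
    · rw [hiff 0 hτ0, heatExponent_nonneg_iff hτ0, ← hLτ]
      exact h0
    · rw [modKernel_eq_scaledKernel m n 0 hτ0,
        scaledKernel_eq (by omega) 0 hτ0 h0 (by rw [hLτ])]
      have key := axis_kernel_eq (n := n) hm one_pos hτ0 hLτ hL0 (x := 1)
        (by rw [hL]; field_simp)
      simp only [norm_zero, ne_eq, OfNat.ofNat_ne_zero, not_false_eq_true, zero_pow, sub_zero,
        zero_mul, add_zero]
      have e : √(2 * ((m : ℝ) + n) * τ * L) ^ (m + 2) =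
          (2 * ((m : ℝ) + n) * τ * L) ^ ((m : ℝ) / 2 + 1) := by
        rw [Real.sqrt_eq_rpow, ← Real.rpow_natCast, ← Real.rpow_mul (by positivity)]
        congr 1
        push_cast
        ring
      rw [e, key]
      simp
  · rintro k ⟨y, s, hs, h, rfl⟩
    rw [hiff y hs] at h
    rw [modKernel_eq_scaledKernel m n y hs]
    simpa using scaledKernel_le hm one_pos hs y h

/-! ### Cut-off profiles. -/

/-- Extension by zero to the left of `0` stays differentiable because value and slope both vanish
there. It is applied to a profile and to its first derivative. -/
theorem hasDerivAt_comp_max_zero {f f' : ℝ → ℝ} (hf : ∀ s, HasDerivAt f (f' s) s)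
    (h0 : f 0 = 0) (h1 : f' 0 = 0) (s : ℝ) :
    HasDerivAt (fun s => f (max s 0)) (f' (max s 0)) s := by
  rcases lt_trichotomy s 0 with hs | rfl | hs
  · rw [max_eq_right hs.le, h1]
    refine (hasDerivAt_const s (0 : ℝ)).congr_of_eventuallyEq ?_
    filter_upwards [eventually_lt_nhds hs] with r hr
    rw [max_eq_right hr.le, h0]
  · rw [max_self, h1, ← hasDerivWithinAt_univ, ← Set.Iic_union_Ici (a := (0 : ℝ))]
    refine HasDerivWithinAt.union ?_ ?_
    · refine (hasDerivWithinAt_const (0 : ℝ) _ (0 : ℝ)).congr (fun r hr => ?_) ?_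
      · rw [max_eq_right hr, h0]
      · rw [max_self, h0]
    · have := (hf 0).hasDerivWithinAt (s := Set.Ici 0)
      rw [h1] at this
      refine this.congr (fun r hr => ?_) ?_
      · rw [max_eq_left hr]
      · rw [max_self]
  · rw [max_eq_left hs.le]
    refine (hf s).congr_of_eventuallyEq ?_
    filter_upwards [eventually_gt_nhds hs] with r hr
    rw [max_eq_left hr.le]

/-- A `C²` profile `g` vanishing on `(-∞, 0]`, with derivatives `g₁` and `g₂`, such that
`0 ≤ g₂ - g₁ ≤ 1`. -/
structure IsProfile (g g₁ g₂ : ℝ → ℝ) : Prop where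
  deriv₀ : ∀ s, HasDerivAt g (g₁ s) s
  deriv₁ : ∀ s, HasDerivAt g₁ (g₂ s) s
  cont₂ : Continuous g₂
  zero₀ : ∀ s ≤ 0, g s = 0
  zero₁ : ∀ s ≤ 0, g₁ s = 0
  zero₂ : ∀ s ≤ 0, g₂ s = 0
  nonneg : ∀ s, 0 ≤ g s
  sub_nonneg : ∀ s, 0 ≤ g₂ s - g₁ s
  sub_le_one : ∀ s, g₂ s - g₁ s ≤ 1

theorem IsProfile.cont₀ {g g₁ g₂ : ℝ → ℝ} (h : IsProfile g g₁ g₂) : Continuous g :=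
  continuous_iff_continuousAt.2 fun s => (h.deriv₀ s).continuousAt

theorem IsProfile.cont₁ {g g₁ g₂ : ℝ → ℝ} (h : IsProfile g g₁ g₂) : Continuous g₁ :=
  continuous_iff_continuousAt.2 fun s => (h.deriv₁ s).continuousAt

/-- The solution of `g'' - g' = 1 - exp (-k s)` with `g 0 = g' 0 = 0`. -/
noncomputable def expProfile (k s : ℝ) : ℝ :=
  k / (k + 1) * Real.exp s - s + (1 - k) / k - Real.exp (-(k * s)) / (k * (k + 1))

/-- The derivative of `expProfile`. -/
noncomputable def expProfileDeriv (k s : ℝ) : ℝ :=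
  k / (k + 1) * Real.exp s - 1 + Real.exp (-(k * s)) / (k + 1)

/-- The second derivative of `expProfile`. -/
noncomputable def expProfileDerivTwo (k s : ℝ) : ℝ :=
  k / (k + 1) * Real.exp s - k / (k + 1) * Real.exp (-(k * s))

theorem hasDerivAt_exp_neg_mul (k s : ℝ) :
    HasDerivAt (fun s => Real.exp (-(k * s))) (Real.exp (-(k * s)) * (-k)) s := by
  have := ((hasDerivAt_id s).const_mul k).neg.exp
  simpa using this

theorem hasDerivAt_expProfile {k : ℝ} (hk : 0 < k) (s : ℝ) :
    HasDerivAt (expProfile k) (expProfileDeriv k s) s := by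
  have := ((((Real.hasDerivAt_exp s).const_mul (k / (k + 1))).sub (hasDerivAt_id s)).add_const
    ((1 - k) / k)).sub ((hasDerivAt_exp_neg_mul k s).div_const (k * (k + 1)))
  refine this.congr_deriv ?_
  rw [expProfileDeriv]
  field_simp
  ring

theorem hasDerivAt_expProfileDeriv {k : ℝ} (s : ℝ) :
    HasDerivAt (expProfileDeriv k) (expProfileDerivTwo k s) s := by
  have := (((Real.hasDerivAt_exp s).const_mul (k / (k + 1))).sub_const 1).add
    ((hasDerivAt_exp_neg_mul k s).div_const (k + 1))
  refine this.congr_deriv ?_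
  rw [expProfileDerivTwo]
  ring

theorem expProfile_zero {k : ℝ} (hk : 0 < k) : expProfile k 0 = 0 := by
  simp [expProfile]; field_simp; ring

theorem expProfileDeriv_zero {k : ℝ} (hk : 0 < k) : expProfileDeriv k 0 = 0 := by
  simp [expProfileDeriv]; field_simp; ring

theorem expProfileDerivTwo_zero (k : ℝ) : expProfileDerivTwo k 0 = 0 := by
  simp [expProfileDerivTwo]

theorem expProfileDerivTwo_sub {k : ℝ} (hk : 0 < k) (s : ℝ) :
    expProfileDerivTwo k s - expProfileDeriv k s = 1 - Real.exp (-(k * s)) := by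
  rw [expProfileDerivTwo, expProfileDeriv]; field_simp; ring

theorem expProfileDerivTwo_nonneg {k s : ℝ} (hk : 0 < k) (hs : 0 ≤ s) :
    0 ≤ expProfileDerivTwo k s := by
  rw [expProfileDerivTwo, ← mul_sub]
  refine mul_nonneg (by positivity) (sub_nonneg.2 (Real.exp_le_exp.2 ?_))
  nlinarith

theorem expProfileDeriv_nonneg {k s : ℝ} (hk : 0 < k) (hs : 0 ≤ s) :
    0 ≤ expProfileDeriv k s := by
  have hm : MonotoneOn (expProfileDeriv k) (Set.Ici 0) := by
    refine monotoneOn_of_deriv_nonneg (convex_Ici 0)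
      (fun x _ => (hasDerivAt_expProfileDeriv x).continuousAt.continuousWithinAt)
      (fun x _ => (hasDerivAt_expProfileDeriv x).differentiableAt.differentiableWithinAt)
      (fun x hx => ?_)
    rw [interior_Ici] at hx
    rw [(hasDerivAt_expProfileDeriv x).deriv]
    exact expProfileDerivTwo_nonneg hk (le_of_lt hx)
  rw [← expProfileDeriv_zero hk]
  exact hm Set.self_mem_Ici hs hs

theorem expProfile_nonneg {k s : ℝ} (hk : 0 < k) (hs : 0 ≤ s) : 0 ≤ expProfile k s := by
  have hm : MonotoneOn (expProfile k) (Set.Ici 0) := by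
    refine monotoneOn_of_deriv_nonneg (convex_Ici 0)
      (fun x _ => (hasDerivAt_expProfile hk x).continuousAt.continuousWithinAt)
      (fun x _ => (hasDerivAt_expProfile hk x).differentiableAt.differentiableWithinAt)
      (fun x hx => ?_)
    rw [interior_Ici] at hx
    rw [(hasDerivAt_expProfile hk x).deriv]
    exact expProfileDeriv_nonneg hk (le_of_lt hx)
  rw [← expProfile_zero hk]
  exact hm Set.self_mem_Ici hs hs

/-- On `s ≥ 0`, `g'' - g' = 1 - e^(-ks)` lies in `[0, 1]` and vanishes at `0`; hence `g''(0) = 0`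
and the extension by zero is `C²`. -/
theorem isProfile_expProfile {k : ℝ} (hk : 0 < k) :
    IsProfile (fun s => expProfile k (max s 0)) (fun s => expProfileDeriv k (max s 0))
      (fun s => expProfileDerivTwo k (max s 0)) where
  deriv₀ := hasDerivAt_comp_max_zero (hasDerivAt_expProfile hk) (expProfile_zero hk)
    (expProfileDeriv_zero hk)
  deriv₁ := hasDerivAt_comp_max_zero hasDerivAt_expProfileDeriv (expProfileDeriv_zero hk)
    (expProfileDerivTwo_zero k)
  cont₂ := by unfold expProfileDerivTwo; fun_prop
  zero₀ s hs := by rw [max_eq_right hs, expProfile_zero hk]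
  zero₁ s hs := by rw [max_eq_right hs, expProfileDeriv_zero hk]
  zero₂ s hs := by rw [max_eq_right hs, expProfileDerivTwo_zero]
  nonneg s := expProfile_nonneg hk (le_max_right _ _)
  sub_nonneg s := by
    rw [expProfileDerivTwo_sub hk, sub_nonneg, Real.exp_le_one_iff, neg_nonpos]
    exact mul_nonneg hk.le (le_max_right _ _)
  sub_le_one s := by
    rw [expProfileDerivTwo_sub hk]
    linarith [Real.exp_pos (-(k * max s 0))]

/-! ### Green's formula on a time slice. -/

variable {m n : ℕ}

/-- The squared Euclidean norm on `ℝ^m × ℝ^n`. -/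
noncomputable def sqNorm (z : EuclideanSpace ℝ (Fin m) × EuclideanSpace ℝ (Fin n)) : ℝ :=
  ‖z.1‖ ^ 2 + ‖z.2‖ ^ 2

/-- The Euclidean inner product on `ℝ^m × ℝ^n`. -/
noncomputable def prodInner (z d : EuclideanSpace ℝ (Fin m) × EuclideanSpace ℝ (Fin n)) : ℝ :=
  inner ℝ z.1 d.1 + inner ℝ z.2 d.2

/-- The standard basis of `ℝ^m × ℝ^n`. -/
noncomputable def stdDir (i : Fin m ⊕ Fin n) :
    EuclideanSpace ℝ (Fin m) × EuclideanSpace ℝ (Fin n) :=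
  Sum.elim (fun i => (EuclideanSpace.single i 1, 0)) (fun j => (0, EuclideanSpace.single j 1)) i

theorem prodInner_stdDir_self (i : Fin m ⊕ Fin n) : prodInner (stdDir i) (stdDir i) = 1 := by
  rcases i with i | j <;> simp [prodInner, stdDir]

theorem sum_prodInner_stdDir_sq (z : EuclideanSpace ℝ (Fin m) × EuclideanSpace ℝ (Fin n)) :
    ∑ i, prodInner z (stdDir i) ^ 2 = sqNorm z := by
  simp [Fintype.sum_sum_type, prodInner, stdDir, sqNorm, EuclideanSpace.norm_sq_eq,
    EuclideanSpace.inner_single_right]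

@[fun_prop]
theorem continuous_sqNorm :
    Continuous (sqNorm : EuclideanSpace ℝ (Fin m) × EuclideanSpace ℝ (Fin n) → ℝ) := by
  unfold sqNorm; fun_prop

@[fun_prop]
theorem continuous_prodInner (d : EuclideanSpace ℝ (Fin m) × EuclideanSpace ℝ (Fin n)) :
    Continuous fun z => prodInner z d := by
  unfold prodInner; fun_prop

theorem sqNorm_nonneg (z : EuclideanSpace ℝ (Fin m) × EuclideanSpace ℝ (Fin n)) :
    0 ≤ sqNorm z := by
  unfold sqNorm; positivity

theorem isCompact_sqNorm_le (C : ℝ) :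
    IsCompact {z : EuclideanSpace ℝ (Fin m) × EuclideanSpace ℝ (Fin n) | sqNorm z ≤ C} := by
  refine ((isCompact_closedBall (0 : EuclideanSpace ℝ (Fin m)) √C).prod
    (isCompact_closedBall (0 : EuclideanSpace ℝ (Fin n)) √C)).of_isClosed_subset
    (isClosed_le continuous_sqNorm continuous_const) fun z hz => ?_
  have hz' : ‖z.1‖ ^ 2 + ‖z.2‖ ^ 2 ≤ C := hz
  rw [Set.mem_prod, mem_closedBall_zero_iff, mem_closedBall_zero_iff]
  constructor <;> apply Real.le_sqrt_of_sq_le <;> nlinarith [sq_nonneg ‖z.1‖, sq_nonneg ‖z.2‖]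

theorem integrable_of_continuous_of_sqNorm
    {f : EuclideanSpace ℝ (Fin m) × EuclideanSpace ℝ (Fin n) → ℝ} (hf : Continuous f) (C : ℝ)
    (h : ∀ z, C < sqNorm z → f z = 0) : Integrable f := by
  refine hf.integrable_of_hasCompactSupport (HasCompactSupport.intro (isCompact_sqNorm_le C) ?_)
  intro z hz
  exact h z (not_le.1 hz)

/-- Along a line `sqNorm` is a quadratic polynomial in the parameter, and its linear coefficient is
`2 * prodInner z d`. -/
theorem hasLineDerivAt_comp_sqNorm {g g₁ : ℝ → ℝ} (hg : ∀ s, HasDerivAt g (g₁ s) s) (a τ : ℝ)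
    (z d : EuclideanSpace ℝ (Fin m) × EuclideanSpace ℝ (Fin n)) :
    HasLineDerivAt ℝ (fun z => g (a - sqNorm z / (4 * τ)))
      (-(g₁ (a - sqNorm z / (4 * τ)) * (prodInner z d / (2 * τ)))) z d := by
  have h1 : HasDerivAt (fun t : ℝ => sqNorm (z + t • d)) (2 * prodInner z d) 0 := by
    have e (t : ℝ) : sqNorm (z + t • d) =
        sqNorm z + t * (2 * prodInner z d) + t ^ 2 * sqNorm d := by
      simp only [sqNorm, prodInner, Prod.fst_add, Prod.snd_add, Prod.smul_fst, Prod.smul_snd,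
        norm_add_sq_real, inner_smul_right, norm_smul, mul_pow, Real.norm_eq_abs, sq_abs]
      ring
    simp only [e]
    have := ((((hasDerivAt_id (0 : ℝ)).mul_const (2 * prodInner z d)).const_add
      (sqNorm z)).add ((hasDerivAt_pow 2 (0 : ℝ)).mul_const (sqNorm d)))
    refine this.congr_deriv ?_
    simp
  have h2 := (hg (a - sqNorm (z + (0 : ℝ) • d) / (4 * τ))).comp (0 : ℝ)
    ((h1.div_const (4 * τ)).const_sub a)
  rw [HasLineDerivAt]
  refine h2.congr_deriv ?_
  simp only [zero_smul, add_zero]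
  ring

theorem hasLineDerivAt_prodInner (z d : EuclideanSpace ℝ (Fin m) × EuclideanSpace ℝ (Fin n)) :
    HasLineDerivAt ℝ (fun z => prodInner z d) (prodInner d d) z d := by
  have e (t : ℝ) : prodInner (z + t • d) d = prodInner z d + t * prodInner d d := by
    simp only [prodInner, Prod.fst_add, Prod.snd_add, Prod.smul_fst, Prod.smul_snd,
      inner_add_left, real_inner_smul_left]
    ring
  rw [HasLineDerivAt]
  simp only [e]
  simpa using ((hasDerivAt_id (0 : ℝ)).mul_const (prodInner d d)).const_add (prodInner z d)

theorem hasLineDerivAt_deriv_comp_sqNorm {g₁ g₂ : ℝ → ℝ} (hg : ∀ s, HasDerivAt g₁ (g₂ s) s)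
    (a τ : ℝ) (z d : EuclideanSpace ℝ (Fin m) × EuclideanSpace ℝ (Fin n)) :
    HasLineDerivAt ℝ (fun z => -(g₁ (a - sqNorm z / (4 * τ)) * (prodInner z d / (2 * τ))))
      (g₂ (a - sqNorm z / (4 * τ)) * (prodInner z d ^ 2 / (4 * τ ^ 2)) -
        g₁ (a - sqNorm z / (4 * τ)) * (prodInner d d / (2 * τ))) z d := by
  have h1 := hasLineDerivAt_comp_sqNorm hg a τ z d
  have h2 := hasLineDerivAt_prodInner z d
  rw [HasLineDerivAt] at *
  have := (h1.mul (h2.div_const (2 * τ))).neg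
  refine this.congr_deriv ?_
  simp only [zero_smul, add_zero]
  ring

theorem hasLineDerivAt_comp_snd {U : EuclideanSpace ℝ (Fin n) → ℝ}
    (z d : EuclideanSpace ℝ (Fin m) × EuclideanSpace ℝ (Fin n)) (hU : DifferentiableAt ℝ U z.2) :
    HasLineDerivAt ℝ (fun z : EuclideanSpace ℝ (Fin m) × EuclideanSpace ℝ (Fin n) => U z.2)
      (fderiv ℝ U z.2 d.2) z d := by
  have := (hU.hasFDerivAt.comp z (hasFDerivAt_snd (𝕜 := ℝ)
    (E := EuclideanSpace ℝ (Fin m)) (F := EuclideanSpace ℝ (Fin n)))).hasLineDerivAt d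
  refine HasDerivAt.congr_deriv this ?_
  simp

/-- Green's formula in one direction. -/
theorem integral_profile_mul_second_deriv {g g₁ g₂ : ℝ → ℝ} (hg : IsProfile g g₁ g₂)
    (a : ℝ) {τ : ℝ} (hτ : 0 < τ) {U : EuclideanSpace ℝ (Fin n) → ℝ} (hU : ContDiff ℝ 2 U)
    (d : EuclideanSpace ℝ (Fin m) × EuclideanSpace ℝ (Fin n)) :
    ∫ z : EuclideanSpace ℝ (Fin m) × EuclideanSpace ℝ (Fin n),
        g (a - sqNorm z / (4 * τ)) * iteratedFDeriv ℝ 2 U z.2 ![d.2, d.2] =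
      ∫ z : EuclideanSpace ℝ (Fin m) × EuclideanSpace ℝ (Fin n),
        (g₂ (a - sqNorm z / (4 * τ)) * (prodInner z d ^ 2 / (4 * τ ^ 2)) -
        g₁ (a - sqNorm z / (4 * τ)) * (prodInner d d / (2 * τ))) * U z.2 := by
  have hlt (z : EuclideanSpace ℝ (Fin m) × EuclideanSpace ℝ (Fin n)) (hz : 4 * τ * a < sqNorm z) :
      a - sqNorm z / (4 * τ) ≤ 0 := by
    rw [sub_nonpos, le_div_iff₀ (by positivity)]
    linarith
  have c0 := hg.cont₀
  have c1 := hg.cont₁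
  have c2 := hg.cont₂
  have hU0 : Continuous U := hU.continuous
  have hfd : ContDiff ℝ 1 (fderiv ℝ U) := hU.fderiv_right (by norm_num)
  have hfd' : ContDiff ℝ 1 fun y => fderiv ℝ U y d.2 := hfd.clm_apply contDiff_const
  have hU1 : Continuous fun y => fderiv ℝ U y d.2 := hfd'.continuous
  have hU2 : Continuous fun y => fderiv ℝ (fun y => fderiv ℝ U y d.2) y d.2 :=
    (hfd'.continuous_fderiv (by norm_num)).clm_apply continuous_const
  have hit (y : EuclideanSpace ℝ (Fin n)) : iteratedFDeriv ℝ 2 U y ![d.2, d.2] =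
      fderiv ℝ (fun y => fderiv ℝ U y d.2) y d.2 := by
    rw [iteratedFDeriv_two_apply, fderiv_clm_apply (hfd.differentiable (by norm_num) y)
      (differentiableAt_const _)]
    simp
  simp only [hit]
  have : (volume : Measure (EuclideanSpace ℝ (Fin m) × EuclideanSpace ℝ (Fin n))).IsAddHaarMeasure :=
    Measure.prod.instIsAddHaarMeasure _ _
  -- Integrate by parts twice. There are no boundary terms: `g`, `g₁` and `g₂` vanish once `sqNorm z
  -- > 4τa`, so all the integrands have compact support.
  have s1 := integral_bilinear_hasLineDerivAt_right_eq_neg_left_of_integrable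
    (μ := (volume : Measure (EuclideanSpace ℝ (Fin m) × EuclideanSpace ℝ (Fin n))))
    (B := ContinuousLinearMap.mul ℝ ℝ) (v := d)
    (f := fun z => g (a - sqNorm z / (4 * τ)))
    (f' := fun z => -(g₁ (a - sqNorm z / (4 * τ)) * (prodInner z d / (2 * τ))))
    (g := fun z => fderiv ℝ U z.2 d.2)
    (g' := fun z => fderiv ℝ (fun y => fderiv ℝ U y d.2) z.2 d.2)
    (by
      refine integrable_of_continuous_of_sqNorm (by simp; fun_prop) (4 * τ * a) fun z hz => ?_
      simp [hg.zero₁ _ (hlt z hz)])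
    (by
      refine integrable_of_continuous_of_sqNorm (by simp; fun_prop) (4 * τ * a) fun z hz => ?_
      simp [hg.zero₀ _ (hlt z hz)])
    (by
      refine integrable_of_continuous_of_sqNorm (by simp; fun_prop) (4 * τ * a) fun z hz => ?_
      simp [hg.zero₀ _ (hlt z hz)])
    (fun z _ => hasLineDerivAt_comp_sqNorm hg.deriv₀ a τ z d)
    (fun z _ => hasLineDerivAt_comp_snd z d (hfd'.differentiable (by norm_num) z.2))
  have s2 := integral_bilinear_hasLineDerivAt_right_eq_neg_left_of_integrable
    (μ := (volume : Measure (EuclideanSpace ℝ (Fin m) × EuclideanSpace ℝ (Fin n))))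
    (B := ContinuousLinearMap.mul ℝ ℝ) (v := d)
    (f := fun z => -(g₁ (a - sqNorm z / (4 * τ)) * (prodInner z d / (2 * τ))))
    (f' := fun z => g₂ (a - sqNorm z / (4 * τ)) * (prodInner z d ^ 2 / (4 * τ ^ 2)) -
        g₁ (a - sqNorm z / (4 * τ)) * (prodInner d d / (2 * τ)))
    (g := fun z => U z.2)
    (g' := fun z => fderiv ℝ U z.2 d.2)
    (by
      refine integrable_of_continuous_of_sqNorm (by simp; fun_prop) (4 * τ * a) fun z hz => ?_
      simp [hg.zero₁ _ (hlt z hz), hg.zero₂ _ (hlt z hz)])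
    (by
      refine integrable_of_continuous_of_sqNorm (by simp; fun_prop) (4 * τ * a) fun z hz => ?_
      simp [hg.zero₁ _ (hlt z hz)])
    (by
      refine integrable_of_continuous_of_sqNorm (by simp; fun_prop) (4 * τ * a) fun z hz => ?_
      simp [hg.zero₁ _ (hlt z hz)])
    (fun z _ => hasLineDerivAt_deriv_comp_sqNorm hg.deriv₁ a τ z d)
    (fun z _ => hasLineDerivAt_comp_snd z d (hU.differentiable (by norm_num) z.2))
  simp only [ContinuousLinearMap.mul_apply'] at s1 s2
  rw [s1, s2, neg_neg]

theorem laplacian_eq_sum_single (U : EuclideanSpace ℝ (Fin n) → ℝ)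
    (y : EuclideanSpace ℝ (Fin n)) :
    Δ U y = ∑ j, iteratedFDeriv ℝ 2 U y
      ![EuclideanSpace.single j 1, EuclideanSpace.single j 1] := by
  rw [InnerProductSpace.laplacian_eq_iteratedFDeriv_orthonormalBasis U
    (EuclideanSpace.basisFun (Fin n) ℝ)]
  simp

theorem continuous_iteratedFDeriv_two {U : EuclideanSpace ℝ (Fin n) → ℝ} (hU : ContDiff ℝ 2 U)
    (v : Fin 2 → EuclideanSpace ℝ (Fin n)) : Continuous fun y => iteratedFDeriv ℝ 2 U y v :=
  (ContinuousMultilinearMap.apply ℝ (fun _ : Fin 2 => EuclideanSpace ℝ (Fin n)) ℝ v).continuous.comp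
    (hU.continuous_iteratedFDeriv le_rfl)

theorem continuous_laplacian {U : EuclideanSpace ℝ (Fin n) → ℝ} (hU : ContDiff ℝ 2 U) :
    Continuous (Δ U) := by
  have : Δ U = fun y => ∑ j, iteratedFDeriv ℝ 2 U y
      ![EuclideanSpace.single j 1, EuclideanSpace.single j 1] :=
    funext (laplacian_eq_sum_single U)
  rw [this]
  exact continuous_finsetSum _ fun j _ => continuous_iteratedFDeriv_two hU _

/-- Green's formula on a time slice. -/
theorem integral_profile_mul_laplacian {g g₁ g₂ : ℝ → ℝ} (hg : IsProfile g g₁ g₂)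
    (a : ℝ) {τ : ℝ} (hτ : 0 < τ) {U : EuclideanSpace ℝ (Fin n) → ℝ} (hU : ContDiff ℝ 2 U) :
    ∫ z : EuclideanSpace ℝ (Fin m) × EuclideanSpace ℝ (Fin n),
        g (a - sqNorm z / (4 * τ)) * Δ U z.2 =
      ∫ z : EuclideanSpace ℝ (Fin m) × EuclideanSpace ℝ (Fin n),
        (g₂ (a - sqNorm z / (4 * τ)) * (sqNorm z / (4 * τ ^ 2)) -
        g₁ (a - sqNorm z / (4 * τ)) * (((m : ℝ) + n) / (2 * τ))) * U z.2 := by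
  have hlt (z : EuclideanSpace ℝ (Fin m) × EuclideanSpace ℝ (Fin n)) (hz : 4 * τ * a < sqNorm z) :
      a - sqNorm z / (4 * τ) ≤ 0 := by
    rw [sub_nonpos, le_div_iff₀ (by positivity)]
    linarith
  have c0 := hg.cont₀
  have c1 := hg.cont₁
  have c2 := hg.cont₂
  have hU0 : Continuous U := hU.continuous
  -- `U` does not depend on `η`, so the `m` extra directions contribute zero here. Including them
  -- completes `prodInner z d ^ 2` to `sqNorm z` and `n` to `m + n` on the other side.
  have e1 (z : EuclideanSpace ℝ (Fin m) × EuclideanSpace ℝ (Fin n)) :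
      g (a - sqNorm z / (4 * τ)) * Δ U z.2 = ∑ i : Fin m ⊕ Fin n,
        g (a - sqNorm z / (4 * τ)) * iteratedFDeriv ℝ 2 U z.2
          ![(stdDir (m := m) i).2, (stdDir (m := m) i).2] := by
    have h0 : iteratedFDeriv ℝ 2 U z.2 ![0, 0] = 0 :=
      (iteratedFDeriv ℝ 2 U z.2).map_coord_zero 0 rfl
    simp [laplacian_eq_sum_single, Fintype.sum_sum_type, stdDir, Finset.mul_sum, h0]
  have e2 (z : EuclideanSpace ℝ (Fin m) × EuclideanSpace ℝ (Fin n)) :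
      (g₂ (a - sqNorm z / (4 * τ)) * (sqNorm z / (4 * τ ^ 2)) -
        g₁ (a - sqNorm z / (4 * τ)) * (((m : ℝ) + n) / (2 * τ))) * U z.2 =
      ∑ i : Fin m ⊕ Fin n,
        (g₂ (a - sqNorm z / (4 * τ)) * (prodInner z (stdDir i) ^ 2 / (4 * τ ^ 2)) -
        g₁ (a - sqNorm z / (4 * τ)) * (prodInner (stdDir (m := m) (n := n) i) (stdDir i) /
          (2 * τ))) * U z.2 := by
    rw [← Finset.sum_mul, Finset.sum_sub_distrib, ← Finset.mul_sum, ← Finset.sum_div,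
      sum_prodInner_stdDir_sq]
    simp only [prodInner_stdDir_self, Finset.sum_const, Finset.card_univ, Fintype.card_sum,
      Fintype.card_fin, nsmul_eq_mul]
    push_cast
    ring
  simp only [e1, e2]
  rw [integral_finsetSum, integral_finsetSum]
  · exact Finset.sum_congr rfl fun i _ => integral_profile_mul_second_deriv hg a hτ hU _
  · intro i _
    refine integrable_of_continuous_of_sqNorm (by fun_prop) (4 * τ * a) fun z hz => ?_
    simp [hg.zero₁ _ (hlt z hz), hg.zero₂ _ (hlt z hz)]
  · intro i _
    have := continuous_iteratedFDeriv_two hU ![(stdDir (m := m) i).2, (stdDir (m := m) i).2]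
    refine integrable_of_continuous_of_sqNorm (by fun_prop) (4 * τ * a) fun z hz => ?_
    simp [hg.zero₀ _ (hlt z hz)]

/-! ### Geometry and compactness of the heatball. -/

/-- The modified heatball of radius `R` in the coordinates `(y, τ)`, where `τ` is the time elapsed
before the centre. -/
def revHeatBall (m n : ℕ) (R : ℝ) : Set (EuclideanSpace ℝ (Fin n) × ℝ) :=
  {p | 0 ≤ p.2 ∧ ‖p.1‖ ^ 2 ≤ 2 * ((m : ℝ) + n) *
    -- `negMulLog` is continuous with value `0` at `0`, so this form is a closed condition and
    -- admits exactly the centre at `τ = 0`.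
    (p.2 * Real.log (R ^ 2 / (4 * Real.pi)) + Real.negMulLog p.2)}

theorem mul_log_add_negMulLog {R τ : ℝ} (hR : 0 < R) (hτ : 0 < τ) :
    τ * Real.log (R ^ 2 / (4 * Real.pi)) + Real.negMulLog τ =
      τ * Real.log (R ^ 2 / (4 * Real.pi * τ)) := by
  rw [← div_div _ (4 * Real.pi), Real.log_div (x := R ^ 2 / (4 * Real.pi)) (by positivity) hτ.ne', Real.negMulLog]
  ring

theorem mem_revHeatBall_iff {R : ℝ} (hR : 0 < R) {p : EuclideanSpace ℝ (Fin n) × ℝ}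
    (hp : 0 < p.2) : p ∈ revHeatBall m n R ↔ 0 ≤ heatExponent m n R (‖p.1‖ ^ 2) p.2 := by
  rw [revHeatBall, Set.mem_ofPred_eq, mul_log_add_negMulLog hR hp, heatExponent_nonneg_iff hp]
  simp only [hp.le, true_and]
  ring_nf

/-- The inequality `log x ≤ x - 1` encloses the heatball in a paraboloid, bounding space and time at
once. -/
theorem le_of_heatExponent_nonneg {R q τ : ℝ} (hR : 0 < R) (hτ : 0 < τ)
    (h : 0 ≤ heatExponent m n R q τ) :
    q ≤ 2 * ((m : ℝ) + n) * (R ^ 2 / (4 * Real.pi) - τ) := by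
  rw [heatExponent_nonneg_iff hτ] at h
  refine h.trans ?_
  rw [mul_assoc (2 * ((m : ℝ) + n))]
  gcongr
  have := Real.log_le_sub_one_of_pos (x := R ^ 2 / (4 * Real.pi * τ)) (by positivity)
  calc τ * Real.log (R ^ 2 / (4 * Real.pi * τ)) ≤ τ * (R ^ 2 / (4 * Real.pi * τ) - 1) := by gcongr
    _ = _ := by field_simp

theorem heatExponent_nonpos_of_le {R q τ : ℝ} (hR : 0 < R) (hq : 0 ≤ q)
    (hτ : R ^ 2 / (4 * Real.pi) ≤ τ) : heatExponent m n R q τ ≤ 0 := by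
  have hτ0 : 0 < τ := lt_of_lt_of_le (by positivity) hτ
  have h1 : Real.log (R ^ 2 / (4 * Real.pi * τ)) ≤ 0 := by
    refine Real.log_nonpos (by positivity) ?_
    rw [← div_div]
    exact div_le_one_of_le₀ hτ hτ0.le
  have h2 : ((m : ℝ) + n) / 2 * Real.log (R ^ 2 / (4 * Real.pi * τ)) ≤ 0 :=
    mul_nonpos_of_nonneg_of_nonpos (by positivity) h1
  have h3 : 0 ≤ q / (4 * τ) := by positivity
  rw [heatExponent]
  linarith

theorem heatExponent_nonpos_of_lt {R q τ : ℝ} (hR : 0 < R) (hτ : 0 < τ)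
    (h : 2 * ((m : ℝ) + n) * (R ^ 2 / (4 * Real.pi)) < q) : heatExponent m n R q τ ≤ 0 := by
  by_contra! h1
  have h2 := le_of_heatExponent_nonneg hR hτ h1.le
  have : 0 ≤ 2 * ((m : ℝ) + n) * τ := by positivity
  linarith

theorem isCompact_revHeatBall (hm : 0 < m) (n : ℕ) {R : ℝ} (hR : 0 < R) : IsCompact (revHeatBall m n R) := by
  have hcl : IsClosed (revHeatBall m n R) :=
    (isClosed_le continuous_const continuous_snd).inter (isClosed_le (by fun_prop)
      (continuous_const.mul ((continuous_snd.mul continuous_const).add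
        (Real.continuous_negMulLog.comp continuous_snd))))
  set c := R ^ 2 / (4 * Real.pi) with hc
  have hc0 : 0 < c := by positivity
  refine ((isCompact_closedBall (0 : EuclideanSpace ℝ (Fin n)) √(2 * ((m : ℝ) + n) * c)).prod
    (isCompact_Icc (a := (0 : ℝ)) (b := c))).of_isClosed_subset hcl ?_
  rintro p hp
  rw [Set.mem_prod, mem_closedBall_zero_iff, Set.mem_Icc]
  rcases hp.1.eq_or_lt with h0 | h0
  · have h1 := hp.2
    rw [← h0, Real.negMulLog_zero, zero_mul, add_zero, mul_zero] at h1
    exact ⟨Real.le_sqrt_of_sq_le (h1.trans (by positivity)), by simp [← h0, hc0.le]⟩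
  · have h1 := le_of_heatExponent_nonneg hR h0 ((mem_revHeatBall_iff hR h0).1 hp)
    have hm' : (0 : ℝ) < m := by exact_mod_cast hm
    refine ⟨Real.le_sqrt_of_sq_le (h1.trans ?_), h0.le, ?_⟩
    · gcongr
      linarith
    · have h2 := nonneg_of_mul_nonneg_right ((sq_nonneg _).trans h1) (by positivity)
      linarith

theorem continuousOn_heatExponent {R : ℝ} (hR : 0 < R) :
    ContinuousOn (fun p : (EuclideanSpace ℝ (Fin m) × EuclideanSpace ℝ (Fin n)) × ℝ =>
      heatExponent m n R (sqNorm p.1) p.2) {p | 0 < p.2} := by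
  unfold heatExponent
  refine ContinuousOn.sub (continuousOn_const.mul (ContinuousOn.log ?_ ?_)) ?_
  · refine continuousOn_const.div (by fun_prop) fun p hp => ?_
    have : 0 < p.2 := hp
    positivity
  · intro p hp
    have : 0 < p.2 := hp
    positivity
  · refine ContinuousOn.div (by fun_prop) (by fun_prop) fun p hp => ?_
    have : 0 < p.2 := hp
    positivity

/-! ### The evolution of `∫ g(ψ) v` in time. -/

theorem hasDerivAt_heatExponent {R : ℝ} (hR : 0 < R) (q : ℝ) {τ : ℝ} (hτ : 0 < τ) :
    HasDerivAt (fun τ => heatExponent m n R q τ)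
      (q / (4 * τ ^ 2) - ((m : ℝ) + n) / (2 * τ)) τ := by
  have h1 : HasDerivAt (fun τ : ℝ => 4 * Real.pi * τ) (4 * Real.pi) τ := by
    simpa using (hasDerivAt_id τ).const_mul (4 * Real.pi)
  have h2 : HasDerivAt (fun τ : ℝ => 4 * τ) 4 τ := by
    simpa using (hasDerivAt_id τ).const_mul (4 : ℝ)
  have h3 := (((h1.fun_inv (by positivity)).const_mul (R ^ 2)).log (by positivity)).const_mul
    (((m : ℝ) + n) / 2)
  have h4 := h3.sub ((h2.fun_inv (by positivity)).const_mul q)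
  simp only [← div_eq_mul_inv] at h4
  refine h4.congr_deriv ?_
  field_simp
  ring

/-- The contribution of a time slice is controlled by the maximum of the kernel. -/
theorem integral_slice_le (hm : 3 ≤ m) {R τ : ℝ} (hR : 0 < R) (hτ : 0 < τ) {θ : ℝ → ℝ}
    (hθ : Continuous θ) (hθ0 : ∀ s ≤ 0, θ s = 0) (hθ1 : ∀ s, 0 ≤ θ s) (hθ2 : ∀ s, θ s ≤ 1)
    {U : EuclideanSpace ℝ (Fin n) → ℝ} (hU : Continuous U) :
    ∫ z : EuclideanSpace ℝ (Fin m) × EuclideanSpace ℝ (Fin n),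
        θ (heatExponent m n R (sqNorm z) τ) * (sqNorm z / (4 * τ ^ 2)) * U z.2 ≤
      modConst m n * R ^ (m - 2) *
        ∫ y, {y | 0 ≤ heatExponent m n R (‖y‖ ^ 2) τ}.indicator (fun y => max (U y) 0) y := by
  set C := 2 * ((m : ℝ) + n) * (R ^ 2 / (4 * Real.pi)) with hC
  have hψ {q : ℝ} (hq : C < q) : heatExponent m n R q τ ≤ 0 := heatExponent_nonpos_of_lt hR hτ hq
  have hcψ : Continuous fun q => heatExponent m n R q τ := by unfold heatExponent; fun_prop
  have hint : Integrable fun z : EuclideanSpace ℝ (Fin m) × EuclideanSpace ℝ (Fin n) =>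
      θ (heatExponent m n R (sqNorm z) τ) * (sqNorm z / (4 * τ ^ 2)) * U z.2 := by
    refine integrable_of_continuous_of_sqNorm (by fun_prop) C fun z hz => ?_
    rw [hθ0 _ (hψ hz), zero_mul, zero_mul]
  have hcball {k : ℕ} (S : Set (EuclideanSpace ℝ (Fin k))) (hS : IsClosed S)
      (h : ∀ y ∈ S, ‖y‖ ^ 2 ≤ C) : IsCompact S := by
    refine (isCompact_closedBall 0 √C).of_isClosed_subset hS fun y hy => ?_
    rw [mem_closedBall_zero_iff]
    exact Real.le_sqrt_of_sq_le (h y hy)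
  have hle {q : ℝ} (h : 0 ≤ heatExponent m n R q τ) : q ≤ C := by
    have := le_of_heatExponent_nonneg hR hτ h
    have h' : 0 ≤ 2 * ((m : ℝ) + n) * τ := by positivity
    linarith
  have hK : IsCompact {y : EuclideanSpace ℝ (Fin n) | 0 ≤ heatExponent m n R (‖y‖ ^ 2) τ} :=
    hcball _ (isClosed_le continuous_const (by fun_prop)) fun y hy => hle hy
  rw [Measure.volume_eq_prod] at hint ⊢
  rw [integral_prod_symm _ hint, ← integral_const_mul]
  refine integral_mono hint.integral_prod_right ?_ fun y => ?_
  · refine Integrable.const_mul ?_ _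
    rw [integrable_indicator_iff hK.isClosed.measurableSet]
    exact (by fun_prop : Continuous fun y => max (U y) 0).continuousOn.integrableOn_compact hK
  · simp only
    rw [integral_mul_const]
    have hI0 : 0 ≤ ∫ η : EuclideanSpace ℝ (Fin m),
        θ (heatExponent m n R (sqNorm (η, y)) τ) * (sqNorm (η, y) / (4 * τ ^ 2)) :=
      integral_nonneg fun η => mul_nonneg (hθ1 _)
        (div_nonneg (sqNorm_nonneg _) (by positivity))
    by_cases hy : 0 ≤ heatExponent m n R (‖y‖ ^ 2) τ
    · rw [Set.indicator_of_mem (s := {y : EuclideanSpace ℝ (Fin n) |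
        0 ≤ heatExponent m n R (‖y‖ ^ 2) τ}) hy]
      have hB : IsCompact {η : EuclideanSpace ℝ (Fin m) |
          0 ≤ heatExponent m n R (‖η‖ ^ 2 + ‖y‖ ^ 2) τ} :=
        hcball _ (isClosed_le continuous_const (by fun_prop)) fun η hη => by
          have := hle hη
          nlinarith [sq_nonneg ‖y‖]
      have hI1 : ∫ η : EuclideanSpace ℝ (Fin m),
          θ (heatExponent m n R (sqNorm (η, y)) τ) * (sqNorm (η, y) / (4 * τ ^ 2)) ≤
          scaledKernel m n R y τ := by
        rw [scaledKernel, ← integral_const_mul, ← integral_indicator hB.isClosed.measurableSet]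
        refine integral_mono_of_nonneg (Filter.Eventually.of_forall fun η => mul_nonneg (hθ1 _)
          (div_nonneg (sqNorm_nonneg _) (by positivity))) ?_
          (Filter.Eventually.of_forall fun η => ?_)
        · rw [integrable_indicator_iff hB.isClosed.measurableSet]
          exact Continuous.continuousOn (by fun_prop) |>.integrableOn_compact hB
        · by_cases hη : 0 ≤ heatExponent m n R (‖η‖ ^ 2 + ‖y‖ ^ 2) τ
          · rw [Set.indicator_of_mem (s := {η : EuclideanSpace ℝ (Fin m) |
              0 ≤ heatExponent m n R (‖η‖ ^ 2 + ‖y‖ ^ 2) τ}) hη]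
            refine (mul_le_of_le_one_left (div_nonneg (sqNorm_nonneg _) (by positivity))
              (hθ2 _)).trans_eq ?_
            simp only [sqNorm]
            ring
          · rw [Set.indicator_of_notMem (s := {η : EuclideanSpace ℝ (Fin m) |
              0 ≤ heatExponent m n R (‖η‖ ^ 2 + ‖y‖ ^ 2) τ}) hη]
            simp only [sqNorm]
            rw [hθ0 _ (not_le.1 hη).le, zero_mul]
      have hI2 := hI1.trans (scaledKernel_le hm hR hτ y hy)
      -- The positive part enters here: a nonnegative weight allows `U ≤ max U 0`, and only then can
      -- the weight be replaced by its upper bound.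
      exact (mul_le_mul_of_nonneg_left (le_max_left _ _) hI0).trans
        (mul_le_mul_of_nonneg_right hI2 (le_max_right _ _))
    · rw [Set.indicator_of_notMem (s := {y : EuclideanSpace ℝ (Fin n) |
        0 ≤ heatExponent m n R (‖y‖ ^ 2) τ}) hy, mul_zero]
      have : ∀ η : EuclideanSpace ℝ (Fin m),
          θ (heatExponent m n R (sqNorm (η, y)) τ) * (sqNorm (η, y) / (4 * τ ^ 2)) = 0 := by
        intro η
        rw [hθ0, zero_mul]
        refine le_trans ?_ (not_le.1 hy).le
        simp only [heatExponent, sqNorm]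
        gcongr
        nlinarith [sq_nonneg ‖η‖]
      simp [this]

theorem hasDerivAt_time {v : EuclideanSpace ℝ (Fin n) × ℝ → ℝ} (hv : Differentiable ℝ v)
    (y : EuclideanSpace ℝ (Fin n)) (s : ℝ) :
    HasDerivAt (fun s => v (y, s)) (fderiv ℝ v (y, s) (0, 1)) s := by
  have h1 : HasDerivAt (fun s : ℝ => (y, s)) ((0 : EuclideanSpace ℝ (Fin n)), (1 : ℝ)) s :=
    (hasDerivAt_const s y).prodMk (hasDerivAt_id s)
  exact (hv (y, s)).hasFDerivAt.comp_hasDerivAt s h1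

/-- The time derivative of `g(ψ) v`. -/
noncomputable def timeDeriv (m n : ℕ) (g g₁ : ℝ → ℝ) (v : EuclideanSpace ℝ (Fin n) × ℝ → ℝ)
    (R : ℝ) (p : (EuclideanSpace ℝ (Fin m) × EuclideanSpace ℝ (Fin n)) × ℝ) : ℝ :=
  g₁ (heatExponent m n R (sqNorm p.1) p.2) *
      (sqNorm p.1 / (4 * p.2 ^ 2) - ((m : ℝ) + n) / (2 * p.2)) * v (p.1.2, p.2) +
    g (heatExponent m n R (sqNorm p.1) p.2) * fderiv ℝ v (p.1.2, p.2) (0, 1)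

theorem hasDerivAt_profile_mul {g g₁ g₂ : ℝ → ℝ} (hg : IsProfile g g₁ g₂)
    {v : EuclideanSpace ℝ (Fin n) × ℝ → ℝ} (hv : Differentiable ℝ v) {R τ : ℝ} (hR : 0 < R)
    (hτ : 0 < τ) (z : EuclideanSpace ℝ (Fin m) × EuclideanSpace ℝ (Fin n)) :
    HasDerivAt (fun τ => g (heatExponent m n R (sqNorm z) τ) * v (z.2, τ))
      (timeDeriv m n g g₁ v R (z, τ)) τ :=
  (((hg.deriv₀ _).comp τ (hasDerivAt_heatExponent hR (sqNorm z) hτ)).mul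
    (hasDerivAt_time hv z.2 τ))

theorem continuousOn_timeDeriv {g g₁ g₂ : ℝ → ℝ} (hg : IsProfile g g₁ g₂)
    {v : EuclideanSpace ℝ (Fin n) × ℝ → ℝ} (hv : ContDiff ℝ 2 v) {R : ℝ} (hR : 0 < R) :
    ContinuousOn (timeDeriv m n g g₁ v R) {p | 0 < p.2} := by
  have h0 := continuousOn_heatExponent (m := m) (n := n) hR
  have hv0 := hv.continuous
  have hv1 : Continuous fun p : EuclideanSpace ℝ (Fin n) × ℝ => fderiv ℝ v p (0, 1) :=
    (hv.continuous_fderiv (by norm_num)).clm_apply continuous_const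
  unfold timeDeriv
  refine ContinuousOn.add (ContinuousOn.mul (ContinuousOn.mul
    (hg.cont₁.comp_continuousOn h0) (ContinuousOn.sub ?_ ?_)) (by fun_prop))
    (ContinuousOn.mul (hg.cont₀.comp_continuousOn h0) ?_)
  · refine ContinuousOn.div (by fun_prop) (by fun_prop) fun p hp => ?_
    have : 0 < p.2 := hp
    positivity
  · refine ContinuousOn.div (by fun_prop) (by fun_prop) fun p hp => ?_
    have : 0 < p.2 := hp
    positivity
  · exact (hv1.comp (by fun_prop : Continuous fun p : (EuclideanSpace ℝ (Fin m) ×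
      EuclideanSpace ℝ (Fin n)) × ℝ => (p.1.2, p.2))).continuousOn

theorem timeDeriv_eq_zero {g g₁ g₂ : ℝ → ℝ} (hg : IsProfile g g₁ g₂)
    (v : EuclideanSpace ℝ (Fin n) × ℝ → ℝ) {R τ : ℝ} (hR : 0 < R) (hτ : 0 < τ)
    {z : EuclideanSpace ℝ (Fin m) × EuclideanSpace ℝ (Fin n)}
    (hz : 2 * ((m : ℝ) + n) * (R ^ 2 / (4 * Real.pi)) < sqNorm z) :
    timeDeriv m n g g₁ v R (z, τ) = 0 := by
  have h := heatExponent_nonpos_of_lt hR hτ hz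
  simp [timeDeriv, hg.zero₀ _ h, hg.zero₁ _ h]

/-- Needed for Fubini. Keeping `τ > ε` avoids the singularity at the centre; there the function is
continuous and vanishes outside a fixed compact set of `z`. -/
theorem integrable_timeDeriv {g g₁ g₂ : ℝ → ℝ} (hg : IsProfile g g₁ g₂)
    {v : EuclideanSpace ℝ (Fin n) × ℝ → ℝ} (hv : ContDiff ℝ 2 v) {R ε c : ℝ} (hR : 0 < R)
    (hε : 0 < ε) :
    Integrable (timeDeriv m n g g₁ v R) (volume.prod (volume.restrict (Set.Ioc ε c))) := by
  have hK := isCompact_sqNorm_le (m := m) (n := n) (2 * ((m : ℝ) + n) * (R ^ 2 / (4 * Real.pi)))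
  have h1 : IntegrableOn (timeDeriv m n g g₁ v R) ({z | sqNorm z ≤
      2 * ((m : ℝ) + n) * (R ^ 2 / (4 * Real.pi))} ×ˢ Set.Icc ε c) (volume.prod volume) := by
    refine ContinuousOn.integrableOn_compact (hK.prod isCompact_Icc)
      ((continuousOn_timeDeriv hg hv hR).mono fun p hp => ?_)
    exact lt_of_lt_of_le hε hp.2.1
  have h2 : IntegrableOn (timeDeriv m n g g₁ v R) (Set.univ ×ˢ Set.Ioc ε c)
      (volume.prod volume) := by
    refine h1.of_forall_sdiff_eq_zero (MeasurableSet.univ.prod measurableSet_Ioc) ?_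
    rintro ⟨z, τ⟩ ⟨⟨-, hτ⟩, hz⟩
    refine timeDeriv_eq_zero hg v hR (hε.trans hτ.1) (not_le.1 fun h => hz ⟨h, hτ.1.le, hτ.2⟩)
  rw [IntegrableOn, ← Measure.prod_restrict, Measure.restrict_univ] at h2
  exact h2

theorem heatExponent_eq_sub (m n : ℕ) (R q τ : ℝ) :
    heatExponent m n R q τ = heatExponent m n R 0 τ - q / (4 * τ) := by
  simp [heatExponent]

/-- On a time slice the derivative of `∫ g(ψ) v` is bounded below. -/
theorem neg_integral_timeDeriv_le (hm : 3 ≤ m) {g g₁ g₂ : ℝ → ℝ} (hg : IsProfile g g₁ g₂)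
    {v : EuclideanSpace ℝ (Fin n) × ℝ → ℝ} (hv : ContDiff ℝ 2 v) {R τ : ℝ} (hR : 0 < R)
    (hτ : 0 < τ) (hH : ∀ p ∈ revHeatBall m n R, 0 < p.2 →
      0 ≤ Δ (fun y => v (y, p.2)) p.1 + deriv (fun s => v (p.1, s)) p.2) :
    -∫ z, timeDeriv m n g g₁ v R (z, τ) ≤ modConst m n * R ^ (m - 2) *
        ∫ y, (revHeatBall m n R).indicator (fun p => max (v p) 0) (y, τ) := by
  have c0 := hg.cont₀
  have c1 := hg.cont₁
  have c2 := hg.cont₂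
  have hU : ContDiff ℝ 2 fun y => v (y, τ) := by fun_prop
  have hU0 := hU.continuous
  have hL := continuous_laplacian hU
  have hv1 : Continuous fun y : EuclideanSpace ℝ (Fin n) => fderiv ℝ v (y, τ) (0, 1) :=
    ((hv.continuous_fderiv (by norm_num)).comp (by fun_prop)).clm_apply continuous_const
  have hcψ : Continuous fun q => heatExponent m n R q τ := by unfold heatExponent; fun_prop
  set C := 2 * ((m : ℝ) + n) * (R ^ 2 / (4 * Real.pi))
  have hψ {q : ℝ} (hq : C < q) : heatExponent m n R q τ ≤ 0 := heatExponent_nonpos_of_lt hR hτ hq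
  have hslice := integral_slice_le hm hR hτ (θ := fun s => g₂ s - g₁ s) (c2.sub c1)
    (fun s hs => by simp [hg.zero₁ s hs, hg.zero₂ s hs]) hg.sub_nonneg hg.sub_le_one hU0
  have hgreen := integral_profile_mul_laplacian (m := m) hg (heatExponent m n R 0 τ) hτ hU
  simp only [← heatExponent_eq_sub] at hgreen
  set A : EuclideanSpace ℝ (Fin m) × EuclideanSpace ℝ (Fin n) → ℝ := fun z =>
    (g₂ (heatExponent m n R (sqNorm z) τ) - g₁ (heatExponent m n R (sqNorm z) τ)) *
      (sqNorm z / (4 * τ ^ 2)) * v (z.2, τ) with hA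
  set B : EuclideanSpace ℝ (Fin m) × EuclideanSpace ℝ (Fin n) → ℝ := fun z =>
    (g₂ (heatExponent m n R (sqNorm z) τ) * (sqNorm z / (4 * τ ^ 2)) -
      g₁ (heatExponent m n R (sqNorm z) τ) * (((m : ℝ) + n) / (2 * τ))) * v (z.2, τ) with hB
  set P : EuclideanSpace ℝ (Fin m) × EuclideanSpace ℝ (Fin n) → ℝ := fun z =>
    g (heatExponent m n R (sqNorm z) τ) * Δ (fun y => v (y, τ)) z.2 with hP
  set Q : EuclideanSpace ℝ (Fin m) × EuclideanSpace ℝ (Fin n) → ℝ := fun z =>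
    g (heatExponent m n R (sqNorm z) τ) * fderiv ℝ v (z.2, τ) (0, 1) with hQ
  have iA : Integrable A := integrable_of_continuous_of_sqNorm (by fun_prop) C fun z hz => by
    simp [hA, hg.zero₁ _ (hψ hz), hg.zero₂ _ (hψ hz)]
  have iB : Integrable B := integrable_of_continuous_of_sqNorm (by fun_prop) C fun z hz => by
    simp [hB, hg.zero₁ _ (hψ hz), hg.zero₂ _ (hψ hz)]
  have iP : Integrable P := integrable_of_continuous_of_sqNorm (by fun_prop) C fun z hz => by
    simp [hP, hg.zero₀ _ (hψ hz)]
  have cQ : Continuous Q :=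
    (c0.comp (hcψ.comp continuous_sqNorm)).mul (hv1.comp continuous_snd)
  have iQ : Integrable Q := integrable_of_continuous_of_sqNorm cQ C fun z hz => by
    simp [hQ, hg.zero₀ _ (hψ hz)]
  -- Green's formula says `∫ B = ∫ P`, so the time derivative integrates to `∫ (P + Q) - ∫ A`. The
  -- first integral is nonnegative by the differential inequality, leaving only `A` to estimate.
  have e1 (z : EuclideanSpace ℝ (Fin m) × EuclideanSpace ℝ (Fin n)) :
      timeDeriv m n g g₁ v R (z, τ) = Q z + (B z - A z) := by
    simp only [timeDeriv, hA, hB, hQ]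
    ring
  have hPQ : 0 ≤ ∫ z, (P z + Q z) := by
    refine integral_nonneg fun z => ?_
    simp only [hP, hQ, ← mul_add, Pi.zero_apply]
    rcases le_or_gt (heatExponent m n R (sqNorm z) τ) 0 with h | h
    · rw [hg.zero₀ _ h, zero_mul]
    · refine mul_nonneg (hg.nonneg _) ?_
      -- Dropping `|η|²` only increases the exponent, so where `g` is nonzero the projected point
      -- lies where the differential inequality is assumed.
      have hmem : (z.2, τ) ∈ revHeatBall m n R := by
        refine (mem_revHeatBall_iff hR hτ).2 (h.le.trans ?_)
        simp only [heatExponent, sqNorm]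
        gcongr
        nlinarith [sq_nonneg ‖z.1‖]
      have := hH _ hmem hτ
      rwa [(hasDerivAt_time (hv.differentiable (by norm_num)) z.2 τ).deriv] at this
  have hind (y : EuclideanSpace ℝ (Fin n)) :
      {y : EuclideanSpace ℝ (Fin n) | 0 ≤ heatExponent m n R (‖y‖ ^ 2) τ}.indicator
        (fun y => max (v (y, τ)) 0) y =
      (revHeatBall m n R).indicator (fun p => max (v p) 0) (y, τ) := by
    have := mem_revHeatBall_iff (m := m) hR (p := (y, τ)) hτ
    simp only [Set.indicator, this, Set.mem_ofPred_eq]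
  simp only [hind] at hslice
  simp only [e1]
  rw [show (fun z => Q z + (B z - A z)) = Q + (B - A) from rfl, integral_add' iQ (iB.sub iA),
    integral_sub' iB iA]
  rw [integral_add iP iQ] at hPQ
  linarith

/-- The integral of `g(ψ) v` over an early time slice is at most a multiple of the integral of
`v⁺` over the modified heatball. -/
theorem integral_profile_mul_le (hm : 3 ≤ m) {g g₁ g₂ : ℝ → ℝ} (hg : IsProfile g g₁ g₂)
    {v : EuclideanSpace ℝ (Fin n) × ℝ → ℝ} (hv : ContDiff ℝ 2 v) {R ε : ℝ} (hR : 0 < R)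
    (hε : 0 < ε) (hεc : ε ≤ R ^ 2 / (4 * Real.pi)) (hH : ∀ p ∈ revHeatBall m n R, 0 < p.2 →
      0 ≤ Δ (fun y => v (y, p.2)) p.1 + deriv (fun s => v (p.1, s)) p.2) :
    ∫ z : EuclideanSpace ℝ (Fin m) × EuclideanSpace ℝ (Fin n),
        g (heatExponent m n R (sqNorm z) ε) * v (z.2, ε) ≤
      modConst m n * R ^ (m - 2) * ∫ p in revHeatBall m n R, max (v p) 0 := by
  set c := R ^ 2 / (4 * Real.pi) with hc
  have hint := integrable_timeDeriv (m := m) (c := c) hg hv hR hε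
  have e1 (z : EuclideanSpace ℝ (Fin m) × EuclideanSpace ℝ (Fin n)) :
      g (heatExponent m n R (sqNorm z) ε) * v (z.2, ε) =
        -∫ τ in Set.Ioc ε c, timeDeriv m n g g₁ v R (z, τ) := by
    have hpos : ∀ τ ∈ Set.uIcc ε c, 0 < τ := fun τ hτ => by
      rw [Set.uIcc_of_le hεc] at hτ
      exact hε.trans_le hτ.1
    -- At the upper endpoint `c = R²/(4π)` the exponent is nonpositive everywhere, so only the value
    -- at `ε` remains.
    rw [← intervalIntegral.integral_of_le hεc, intervalIntegral.integral_eq_sub_of_hasDerivAt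
      (fun τ hτ => hasDerivAt_profile_mul hg (hv.differentiable (by norm_num)) hR (hpos τ hτ) z)
      (ContinuousOn.intervalIntegrable ((continuousOn_timeDeriv hg hv hR).comp (by fun_prop)
        fun τ hτ => hpos τ hτ)),
      hg.zero₀ _ (heatExponent_nonpos_of_le hR (sqNorm_nonneg z) le_rfl)]
    ring
  have hE := (isCompact_revHeatBall (by omega : 0 < m) n hR)
  have hmE := hE.isClosed.measurableSet
  have hv0 := hv.continuous
  have hind : Integrable ((revHeatBall m n R).indicator fun p => max (v p) 0)
      (volume.prod volume) := by
    rw [← Measure.volume_eq_prod, integrable_indicator_iff hmE]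
    exact (by fun_prop : Continuous fun p => max (v p) 0).continuousOn.integrableOn_compact hE
  have hpos : 0 ≤ modConst m n * R ^ (m - 2) := mul_nonneg (modConst_nonneg hm) (by positivity)
  have hfub := integral_prod_symm _ hind
  rw [← Measure.volume_eq_prod] at hfub
  simp only [e1]
  rw [integral_neg, integral_integral_swap (f := fun z τ => timeDeriv m n g g₁ v R (z, τ)) hint, ← integral_neg, ← integral_indicator hmE, hfub]
  calc ∫ τ in Set.Ioc ε c, -∫ z, timeDeriv m n g g₁ v R (z, τ)
      ≤ ∫ τ in Set.Ioc ε c, modConst m n * R ^ (m - 2) *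
        ∫ y, (revHeatBall m n R).indicator (fun p => max (v p) 0) (y, τ) := by
        refine setIntegral_mono_on hint.integral_prod_right.neg
          (hind.integral_prod_right.integrableOn.const_mul _) measurableSet_Ioc fun τ hτ => ?_
        exact neg_integral_timeDeriv_le hm hg hv hR (hε.trans hτ.1) hH
    _ ≤ _ := by
        rw [integral_const_mul]
        refine mul_le_mul_of_nonneg_left (setIntegral_le_integral hind.integral_prod_right
          (Filter.Eventually.of_forall fun τ => integral_nonneg fun y => ?_)) hpos
        exact Set.indicator_nonneg (fun p _ => le_max_right _ _) _

/-! ### Concentration at the centre. -/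

theorem integral_exp_neg_sqNorm (m n : ℕ) :
    ∫ z : EuclideanSpace ℝ (Fin m) × EuclideanSpace ℝ (Fin n), Real.exp (-(sqNorm z / 4)) =
      (4 * Real.pi) ^ (((m : ℝ) + n) / 2) := by
  have e (z : EuclideanSpace ℝ (Fin m) × EuclideanSpace ℝ (Fin n)) :
      Real.exp (-(sqNorm z / 4)) =
        Real.exp (-(1 / 4) * ‖z.1‖ ^ 2) * Real.exp (-(1 / 4) * ‖z.2‖ ^ 2) := by
    rw [← Real.exp_add, sqNorm]
    ring_nf
  simp only [e]
  rw [Measure.volume_eq_prod, integral_prod_mul (fun η : EuclideanSpace ℝ (Fin m) =>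
      Real.exp (-(1 / 4) * ‖η‖ ^ 2)) (fun y : EuclideanSpace ℝ (Fin n) =>
      Real.exp (-(1 / 4) * ‖y‖ ^ 2)),
    GaussianFourier.integral_rexp_neg_mul_sq_norm (by norm_num),
    GaussianFourier.integral_rexp_neg_mul_sq_norm (by norm_num),
    ← Real.rpow_add (by positivity)]
  simp only [finrank_euclideanSpace, Fintype.card_fin]
  congr 1 <;> ring

theorem integrable_exp_neg_sqNorm (m n : ℕ) :
    Integrable fun z : EuclideanSpace ℝ (Fin m) × EuclideanSpace ℝ (Fin n) =>
      Real.exp (-(sqNorm z / 4)) := by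
  -- A non-integrable function has integral `0` by convention, contradicting the positive value
  -- already computed.
  by_contra h
  have h1 := integral_exp_neg_sqNorm m n
  rw [integral_undef h] at h1
  have : 0 < (4 * Real.pi) ^ (((m : ℝ) + n) / 2) := by positivity
  linarith

/-- Self-similarity of the heat kernel: under `z ↦ √ε z` the Jacobian absorbs all dependence on `ε`,
leaving a fixed Gaussian. -/
theorem sqrt_pow_mul_exp_heatExponent {R ε q : ℝ} (hR : 0 < R) (hε : 0 < ε) :
    √ε ^ (m + n) * Real.exp (heatExponent m n R (ε * q) ε) =
      (R ^ 2 / (4 * Real.pi)) ^ (((m : ℝ) + n) / 2) * Real.exp (-(q / 4)) := by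
  have h1 : √ε ^ (m + n) = Real.exp (((m : ℝ) + n) / 2 * Real.log ε) := by
    rw [Real.sqrt_eq_rpow, ← Real.rpow_natCast, ← Real.rpow_mul hε.le, Real.rpow_def_of_pos hε]
    congr 1
    push_cast
    ring
  rw [h1, ← Real.exp_add, Real.rpow_def_of_pos (by positivity), ← Real.exp_add, heatExponent,
    ← div_div (R ^ 2), Real.log_div (x := R ^ 2 / (4 * Real.pi)) (by positivity) hε.ne']
  congr 1
  field_simp
  ring

theorem integral_slice_rescale (m n : ℕ) {ε : ℝ} (hε : 0 < ε)
    (f : EuclideanSpace ℝ (Fin m) × EuclideanSpace ℝ (Fin n) → ℝ) :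
    ∫ z, f z = ∫ z, √ε ^ (m + n) * f (√ε • z) := by
  have : (volume : Measure (EuclideanSpace ℝ (Fin m) × EuclideanSpace ℝ (Fin n))).IsAddHaarMeasure :=
    Measure.prod.instIsAddHaarMeasure _ _
  rw [integral_const_mul, Measure.integral_comp_smul_of_nonneg _ _ _ (hR := Real.sqrt_nonneg ε)]
  have hf : Module.finrank ℝ (EuclideanSpace ℝ (Fin m) × EuclideanSpace ℝ (Fin n)) = m + n := by
    simp
  rw [hf, smul_eq_mul, mul_inv_cancel_left₀ (by positivity)]

theorem sqNorm_smul (r : ℝ) (z : EuclideanSpace ℝ (Fin m) × EuclideanSpace ℝ (Fin n)) :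
    sqNorm (r • z) = r ^ 2 * sqNorm z := by
  simp only [sqNorm, Prod.smul_fst, Prod.smul_snd, norm_smul, mul_pow, Real.norm_eq_abs, sq_abs]
  ring

open Filter Topology

theorem tendsto_heatExponent_rescale (hm : 0 < m) {R : ℝ} (hR : 0 < R) (q : ℝ) :
    Tendsto (fun ε => heatExponent m n R (ε * q) ε) (𝓝[>] 0) atTop := by
  have h1 : Tendsto (fun ε : ℝ => R ^ 2 / (4 * Real.pi) * ε⁻¹) (𝓝[>] 0) atTop :=
    tendsto_inv_nhdsGT_zero.const_mul_atTop (by positivity)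
  have hm' : (0 : ℝ) < m := by exact_mod_cast hm
  have h2 := tendsto_atTop_add_const_right _ (-(q / 4))
    ((Real.tendsto_log_atTop.comp h1).const_mul_atTop (r := ((m : ℝ) + n) / 2) (by positivity))
  refine h2.congr' ?_
  filter_upwards [self_mem_nhdsWithin] with ε hε
  have hε' : (0 : ℝ) < ε := hε
  simp only [heatExponent, Function.comp]
  have e1 : R ^ 2 / (4 * Real.pi) * ε⁻¹ = R ^ 2 / (4 * Real.pi * ε) := by field_simp
  have e2 : ε * q / (4 * ε) = q / 4 := by field_simp
  rw [e1, e2]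
  ring

/-- Concentration at the centre: the early time slices recover the value at the centre. -/
theorem tendsto_integral_profile_mul (hm : 0 < m) {g : ℝ → ℝ} (hgc : Continuous g) {A : ℝ}
    (hg0 : ∀ s, 0 ≤ g s) (hg1 : ∀ s, g s ≤ Real.exp s)
    (hgA : Tendsto (fun s => g s * Real.exp (-s)) atTop (𝓝 A))
    {v : EuclideanSpace ℝ (Fin n) × ℝ → ℝ} (hv : Continuous v) (hvc : HasCompactSupport v)
    {R : ℝ} (hR : 0 < R) :
    Tendsto (fun ε => ∫ z : EuclideanSpace ℝ (Fin m) × EuclideanSpace ℝ (Fin n),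
        g (heatExponent m n R (sqNorm z) ε) * v (z.2, ε)) (𝓝[>] 0)
      (𝓝 (A * R ^ (m + n) * v 0)) := by
  obtain ⟨V, hV⟩ := hvc.exists_bound_of_continuous hv
  set c := R ^ 2 / (4 * Real.pi) with hc
  have hc0 : 0 < c := by positivity
  set K := c ^ (((m : ℝ) + n) / 2) with hK
  have hK0 : 0 < K := by positivity
  set h : ℝ → EuclideanSpace ℝ (Fin m) × EuclideanSpace ℝ (Fin n) → ℝ := fun ε z =>
    √ε ^ (m + n) * (g (heatExponent m n R (ε * sqNorm z) ε) * v (√ε • z.2, ε)) with hh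
  have e1 : (fun ε => ∫ z, h ε z) =ᶠ[𝓝[>] 0] fun ε =>
      ∫ z : EuclideanSpace ℝ (Fin m) × EuclideanSpace ℝ (Fin n),
        g (heatExponent m n R (sqNorm z) ε) * v (z.2, ε) := by
    filter_upwards [self_mem_nhdsWithin] with ε hε
    rw [integral_slice_rescale m n hε (fun z => g (heatExponent m n R (sqNorm z) ε) * v (z.2, ε))]
    simp only [hh, sqNorm_smul, Real.sq_sqrt (le_of_lt hε), Prod.smul_snd]
  refine Tendsto.congr' e1 ?_
  have e2 : A * R ^ (m + n) * v 0 =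
      ∫ z : EuclideanSpace ℝ (Fin m) × EuclideanSpace ℝ (Fin n),
        A * K * v 0 * Real.exp (-(sqNorm z / 4)) := by
    have : K * (4 * Real.pi) ^ (((m : ℝ) + n) / 2) = R ^ (m + n) := by
      rw [hK, ← Real.mul_rpow hc0.le (by positivity), hc, div_mul_cancel₀ _ (by positivity),
        ← Real.rpow_natCast R 2, ← Real.rpow_mul hR.le, ← Real.rpow_natCast R (m + n)]
      congr 1
      push_cast
      ring
    rw [integral_const_mul, integral_exp_neg_sqNorm, ← this]
    ring
  rw [e2]
  -- After rescaling, `g ≤ exp` supplies a fixed Gaussian majorant. Pointwise the exponent tends to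
  -- infinity, so `g` may be replaced by `A exp`, and `v` is evaluated at points tending to the
  -- centre.
  refine tendsto_integral_filter_of_dominated_convergence
    (fun z => K * V * Real.exp (-(sqNorm z / 4))) ?_ ?_
    ((integrable_exp_neg_sqNorm m n).const_mul _) (Eventually.of_forall fun z => ?_)
  · refine Eventually.of_forall fun ε => Continuous.aestronglyMeasurable ?_
    simp only [hh, heatExponent]
    fun_prop
  · filter_upwards [self_mem_nhdsWithin] with ε hε
    refine Eventually.of_forall fun z => ?_
    have hs := sqrt_pow_mul_exp_heatExponent (m := m) (n := n) (q := sqNorm z) hR hε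
    simp only [hh]
    rw [← mul_assoc, norm_mul, Real.norm_of_nonneg (mul_nonneg (by positivity) (hg0 _))]
    calc √ε ^ (m + n) * g (heatExponent m n R (ε * sqNorm z) ε) * ‖v (√ε • z.2, ε)‖
        ≤ √ε ^ (m + n) * Real.exp (heatExponent m n R (ε * sqNorm z) ε) * V := by
          gcongr
          · exact hg1 _
          · exact hV _
      _ = _ := by rw [hs]; ring
  · have t1 := hgA.comp (tendsto_heatExponent_rescale (n := n) hm hR (sqNorm z))
    have t2 : Tendsto (fun ε : ℝ => v (√ε • z.2, ε)) (𝓝[>] 0) (𝓝 (v 0)) := by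
      have : Continuous fun ε : ℝ => v (√ε • z.2, ε) := by fun_prop
      have h0 := this.tendsto 0
      simp only [Real.sqrt_zero, zero_smul] at h0
      exact h0.mono_left nhdsWithin_le_nhds
    have t3 := ((t1.mul_const (K * Real.exp (-(sqNorm z / 4)))).mul t2)
    have e3 : A * K * v 0 * Real.exp (-(sqNorm z / 4)) =
        A * (K * Real.exp (-(sqNorm z / 4))) * v 0 := by ring
    rw [e3]
    refine t3.congr' ?_
    filter_upwards [self_mem_nhdsWithin] with ε hε
    have hs := sqrt_pow_mul_exp_heatExponent (m := m) (n := n) (q := sqNorm z) hR hε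
    rw [← hs]
    simp only [hh, Function.comp, Real.exp_neg]
    field_simp

/-! ### The inequality at the origin. -/

theorem expProfile_le_exp {k : ℝ} (hk : 1 ≤ k) {s : ℝ} (hs : 0 ≤ s) :
    expProfile k s ≤ Real.exp s := by
  have h1 : k / (k + 1) * Real.exp s ≤ Real.exp s :=
    mul_le_of_le_one_left (Real.exp_pos s).le (div_le_one_of_le₀ (by linarith) (by linarith))
  have h2 : (1 - k) / k ≤ 0 := div_nonpos_of_nonpos_of_nonneg (by linarith) (by linarith)
  have h3 : 0 ≤ Real.exp (-(k * s)) / (k * (k + 1)) := by positivity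
  rw [expProfile]
  linarith

theorem tendsto_expProfile_mul_exp_neg {k : ℝ} (hk : 0 < k) :
    Tendsto (fun s => expProfile k (max s 0) * Real.exp (-s)) atTop (𝓝 (k / (k + 1))) := by
  have t1 : Tendsto (fun s : ℝ => Real.exp (-s)) atTop (𝓝 0) := Real.tendsto_exp_neg_atTop_nhds_zero
  have t2 : Tendsto (fun s : ℝ => s * Real.exp (-s)) atTop (𝓝 0) := by
    simpa using Real.tendsto_pow_mul_exp_neg_atTop_nhds_zero 1
  have t3 : Tendsto (fun s : ℝ => Real.exp (-(k * s))) atTop (𝓝 0) :=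
    t1.comp (tendsto_id.const_mul_atTop hk)
  have t4 := (((tendsto_const_nhds (x := k / (k + 1))).sub t2).add (t1.const_mul ((1 - k) / k))).sub
    ((t3.mul t1).div_const (k * (k + 1)))
  simp only [sub_zero, mul_zero, add_zero, zero_div] at t4
  refine t4.congr' ?_
  filter_upwards [eventually_ge_atTop 0] with s hs
  rw [max_eq_left hs, expProfile, Real.exp_neg s]
  field_simp

/-- The mean value inequality at the origin, for compactly supported functions, in reversed
time. -/
theorem le_integral_revHeatBall (hm : 3 ≤ m) {v : EuclideanSpace ℝ (Fin n) × ℝ → ℝ}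
    (hv : ContDiff ℝ 2 v) (hvc : HasCompactSupport v) {R : ℝ} (hR : 0 < R)
    (hH : ∀ p ∈ revHeatBall m n R, 0 < p.2 →
      0 ≤ Δ (fun y => v (y, p.2)) p.1 + deriv (fun s => v (p.1, s)) p.2) :
    v 0 ≤ modConst m n / R ^ (n + 2) * ∫ p in revHeatBall m n R, max (v p) 0 := by
  set I := ∫ p in revHeatBall m n R, max (v p) 0
  -- The profile parameter is `k + 1`, which is at least `1` as the bound by `exp` requires; its
  -- leading coefficient tends to `1`.
  have hk (k : ℕ) : ((k : ℝ) + 1) / ((k : ℝ) + 1 + 1) * R ^ (m + n) * v 0 ≤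
      modConst m n * R ^ (m - 2) * I := by
    have hk0 : (0 : ℝ) < (k : ℝ) + 1 := by positivity
    have hg := isProfile_expProfile hk0
    have ht := tendsto_integral_profile_mul (by omega : 0 < m) hg.cont₀ hg.nonneg (fun s => by
      rcases le_total 0 s with hs | hs
      · simpa [max_eq_left hs] using expProfile_le_exp (by simp) hs
      · simpa [max_eq_right hs, expProfile_zero hk0] using (Real.exp_pos s).le)
      (tendsto_expProfile_mul_exp_neg hk0) hv.continuous hvc hR
    refine le_of_tendsto ht ?_
    have hc0 : 0 < R ^ 2 / (4 * Real.pi) := by positivity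
    filter_upwards [Ioc_mem_nhdsGT hc0] with ε hε
    exact integral_profile_mul_le hm hg hv hR hε.1 hε.2 hH
  have ht : Tendsto (fun k : ℕ => ((k : ℝ) + 1) / ((k : ℝ) + 1 + 1) * R ^ (m + n) * v 0) atTop
      (𝓝 (1 * R ^ (m + n) * v 0)) := by
    have h1 := (tendsto_natCast_div_add_atTop (1 : ℝ)).comp (tendsto_add_atTop_nat 1)
    refine (h1.mul_const _).mul_const _ |>.congr fun k => ?_
    simp
  have hlim := le_of_tendsto' ht hk
  have hpow : R ^ (m + n) = R ^ (m - 2) * R ^ (n + 2) := by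
    rw [← pow_add]
    congr 1
    omega
  rw [hpow, one_mul] at hlim
  have h1 : 0 < R ^ (m - 2) := by positivity
  have h2 : R ^ (n + 2) * v 0 ≤ modConst m n * I := by
    refine le_of_mul_le_mul_left ?_ h1
    linarith
  rw [div_mul_eq_mul_div, le_div_iff₀' (by positivity)]
  exact h2

/-! ### Translation, time reversal and localisation. -/

/-- `η = 0` maximises the kernel over each fibre, so the projection equals the slice `η = 0`; the
centre corresponds to the point with `τ = 0`. -/
theorem modHeatBall_eq_preimage (m : ℕ) (x : EuclideanSpace ℝ (Fin n)) (t : ℝ) {R : ℝ}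
    (hR : 0 < R) :
    modHeatBall m x t R = (fun p => (x, t) - p) ⁻¹' revHeatBall m n R := by
  have hsub (η : EuclideanSpace ℝ (Fin m)) (y : EuclideanSpace ℝ (Fin n)) :
      pair 0 x - pair η y = pair (-η) (x - y) := by
    ext i
    rcases i with i | i <;> simp [pair]
  ext ⟨y, s⟩
  simp only [Set.mem_preimage, Prod.mk_sub_mk]
  constructor
  · rintro ⟨η, h | ⟨h1, h2⟩⟩
    · have h' := Prod.ext_iff.1 (Set.mem_singleton_iff.1 h)
      have hy : y = x := by
        ext i
        have := congrArg (fun w => w (Sum.inr i)) h'.1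
        simpa [pair] using this
      have hs : s = t := h'.2
      simp [revHeatBall, hy, hs]
    · have hpos : 0 < t - s := sub_pos.2 h1
      simp only [hsub, Fintype.card_sum, Fintype.card_fin] at h2
      rw [le_heatKernel_pair_iff _ _ hR hpos] at h2
      refine (mem_revHeatBall_iff hR hpos).2 (h2.trans ?_)
      simp only [heatExponent]
      gcongr
      nlinarith [sq_nonneg ‖-η‖]
  · intro h
    refine ⟨0, ?_⟩
    rcases h.1.eq_or_lt with h0 | h0
    · left
      have h1 := h.2
      simp only at h0 h1
      rw [← h0, Real.negMulLog_zero, zero_mul, add_zero, mul_zero] at h1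
      have hy : x - y = 0 := by
        rw [← norm_eq_zero]
        exact pow_eq_zero_iff two_ne_zero |>.1 (le_antisymm h1 (sq_nonneg _))
      rw [Set.mem_singleton_iff, sub_eq_zero.1 hy, sub_eq_zero.1 h0.symm]
    · right
      refine ⟨sub_pos.1 h0, ?_⟩
      simp only [hsub, Fintype.card_sum, Fintype.card_fin]
      rw [le_heatKernel_pair_iff _ _ hR h0]
      simpa using (mem_revHeatBall_iff hR h0).1 h

theorem isCompact_modHeatBall (hm : 0 < m) (x : EuclideanSpace ℝ (Fin n)) (t : ℝ) {R : ℝ}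
    (hR : 0 < R) : IsCompact (modHeatBall m x t R) := by
  rw [modHeatBall_eq_preimage m x t hR]
  exact (Homeomorph.subLeft (x, t)).isCompact_preimage.2 (isCompact_revHeatBall hm n hR)

theorem fderiv_comp_const_sub_left {E F : Type*} [NormedAddCommGroup E] [NormedSpace ℝ E]
    [NormedAddCommGroup F] [NormedSpace ℝ F] {f : E → F} (hf : Differentiable ℝ f) (x y : E) :
    fderiv ℝ (fun y => f (x - y)) y = -fderiv ℝ f (x - y) := by
  have h := (hf (x - y)).hasFDerivAt.comp y ((hasFDerivAt_id y).const_sub x)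
  refine (HasFDerivAt.fderiv h).trans ?_
  ext
  simp

theorem laplacian_comp_const_sub_left {f : EuclideanSpace ℝ (Fin n) → ℝ} (hf : ContDiff ℝ 2 f)
    (x y : EuclideanSpace ℝ (Fin n)) : Δ (fun y => f (x - y)) y = Δ f (x - y) := by
  have h1 : fderiv ℝ (fun y => f (x - y)) = fun y => -fderiv ℝ f (x - y) :=
    funext (fderiv_comp_const_sub_left (hf.differentiable (by norm_num)) x)
  have h2 : Differentiable ℝ (fderiv ℝ f) :=
    (hf.fderiv_right (m := 1) (by norm_num)).differentiable (by norm_num)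
  simp only [laplacian_eq_sum_single, iteratedFDeriv_two_apply, h1, fderiv_fun_neg,
    fderiv_comp_const_sub_left h2, neg_neg]

/-- A `C²` function on a neighbourhood of a compact set agrees near that set with a globally `C²`
function of compact support. -/
theorem exists_contDiff_eventuallyEq {E : Type*} [NormedAddCommGroup E] [NormedSpace ℝ E]
    [FiniteDimensional ℝ E] {Ω K : Set E} (hΩ : IsOpen Ω) (hK : IsCompact K) (hKΩ : K ⊆ Ω)
    {u : E → ℝ} (hu : ContDiffOn ℝ 2 u Ω) :
    ∃ w : E → ℝ, ContDiff ℝ 2 w ∧ HasCompactSupport w ∧ ∀ p ∈ K, w =ᶠ[𝓝 p] u := by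
  obtain ⟨L, hL, hKL, hLΩ⟩ := exists_compact_between hK hΩ hKΩ
  obtain ⟨χ, h1, h0, -⟩ := exists_contMDiffMap_one_nhds_of_subset_interior
    (modelWithCornersSelf ℝ E) (n := 2) hK.isClosed hKL
  have hχ : ContDiff ℝ 2 χ := χ.contMDiff.contDiff
  refine ⟨fun p => χ p * u p, ?_, ?_, ?_⟩
  · rw [contDiff_iff_contDiffAt]
    intro p
    by_cases hp : p ∈ Ω
    · exact hχ.contDiffAt.mul (hu.contDiffAt (hΩ.mem_nhds hp))
    · refine (contDiffAt_const (c := (0 : ℝ))).congr_of_eventuallyEq ?_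
      filter_upwards [hL.isClosed.isOpen_compl.mem_nhds fun h => hp (hLΩ h)] with r hr
      rw [h0 r hr, zero_mul]
  · exact HasCompactSupport.intro hL fun p hp => by rw [h0 p hp, zero_mul]
  · intro p hp
    filter_upwards [h1.filter_mono (nhds_le_nhdsSet hp)] with r hr
    rw [hr, one_mul]

theorem heatOp_congr {u w : EuclideanSpace ℝ (Fin n) × ℝ → ℝ} {p : EuclideanSpace ℝ (Fin n) × ℝ}
    (h : w =ᶠ[𝓝 p] u) : heatOp w p = heatOp u p := by
  have c1 : Tendsto (fun y => (y, p.2)) (𝓝 p.1) (𝓝 p) :=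
    (by fun_prop : Continuous fun y : EuclideanSpace ℝ (Fin n) => (y, p.2)).tendsto p.1
  have c2 : Tendsto (fun s => (p.1, s)) (𝓝 p.2) (𝓝 p) :=
    (by fun_prop : Continuous fun s : ℝ => (p.1, s)).tendsto p.2
  have e1 : Δ (fun y => w (y, p.2)) p.1 = Δ (fun y => u (y, p.2)) p.1 :=
    (InnerProductSpace.laplacian_congr_nhds (h.comp_tendsto c1)).self_of_nhds
  have e2 : (fun s => w (p.1, s)) =ᶠ[𝓝 p.2] fun s => u (p.1, s) := h.comp_tendsto c2
  rw [heatOp, heatOp, e1, e2.deriv_eq]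

/-- Cut `u` off outside a neighbourhood of the compact heatball, then reflect through the centre:
the Laplacian is unchanged and the time derivative changes sign. Agreement of germs on the heatball
transfers the differential inequality up to its boundary. -/
theorem le_integral_modHeatBall (hm : 3 ≤ m) {Ω : Set (EuclideanSpace ℝ (Fin n) × ℝ)}
    {u : EuclideanSpace ℝ (Fin n) × ℝ → ℝ} (hΩ : IsOpen Ω) (hu : ContDiffOn ℝ 2 u Ω)
    (hH : ∀ p ∈ Ω, 0 ≤ heatOp u p) (x : EuclideanSpace ℝ (Fin n)) (t : ℝ) {R : ℝ} (hR : 0 < R)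
    (hE : modHeatBall m x t R ⊆ Ω) :
    u (x, t) ≤ modConst m n / R ^ (n + 2) * ∫ p in modHeatBall m x t R, max (u p) 0 := by
  have hm0 : 0 < m := by omega
  have hKc := isCompact_modHeatBall hm0 x t hR
  have hpre := modHeatBall_eq_preimage m x t hR
  obtain ⟨w, hw, hwc, hwu⟩ := exists_contDiff_eventuallyEq hΩ hKc hE hu
  set v : EuclideanSpace ℝ (Fin n) × ℝ → ℝ := fun p => w ((x, t) - p) with hv
  have hmem : ∀ p ∈ revHeatBall m n R, (x, t) - p ∈ modHeatBall m x t R := fun p hp => by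
    rw [hpre, Set.mem_preimage, sub_sub_cancel]
    exact hp
  have hvd : ContDiff ℝ 2 v := by fun_prop
  have hvc : HasCompactSupport v := hwc.comp_homeomorph (Homeomorph.subLeft (x, t))
  have key := le_integral_revHeatBall hm hvd hvc hR fun p hp _ => by
    have h1 := heatOp_congr (hwu _ (hmem p hp))
    have h2 := hH _ (hE (hmem p hp))
    rw [← h1, heatOp] at h2
    have e1 : Δ (fun y => v (y, p.2)) p.1 = Δ (fun y => w (y, t - p.2)) (x - p.1) :=
      laplacian_comp_const_sub_left (f := fun y => w (y, t - p.2)) (by fun_prop) x p.1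
    have e2 : deriv (fun s => v (p.1, s)) p.2 = -deriv (fun s => w (x - p.1, s)) (t - p.2) :=
      deriv_comp_const_sub (f := fun s => w (x - p.1, s)) t p.2
    rw [e1, e2]
    simp only [Prod.fst_sub, Prod.snd_sub] at h2
    linarith
  have hcenter : (x, t) ∈ modHeatBall m x t R := by
    rw [hpre, Set.mem_preimage, sub_self]
    simp [revHeatBall]
  have hv0 : v 0 = u (x, t) := by
    rw [hv]
    simpa using (hwu _ hcenter).self_of_nhds
  have hint : ∫ p in revHeatBall m n R, max (v p) 0 =
      ∫ p in modHeatBall m x t R, max (u p) 0 := by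
    have hinv : (volume : Measure (EuclideanSpace ℝ (Fin n) × ℝ)).IsAddHaarMeasure :=
      Measure.prod.instIsAddHaarMeasure _ _
    have hmp : MeasurePreserving (fun p : EuclideanSpace ℝ (Fin n) × ℝ => (x, t) - p) :=
      Measure.measurePreserving_sub_left volume (x, t)
    have := hmp.setIntegral_preimage_emb (Homeomorph.subLeft (x, t)).measurableEmbedding
      (fun p => max (v p) 0) (revHeatBall m n R)
    rw [← this, ← hpre]
    refine setIntegral_congr_fun hKc.isClosed.measurableSet fun p hp => ?_
    simp only [hv, sub_sub_cancel]
    rw [(hwu p hp).self_of_nhds]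
  rwa [hv0, hint] at key

end HeatMean

theorem mainTheorem8 (m n : ℕ) (hm : 3 ≤ m) :
    IsGreatest
      {k : ℝ | ∃ (y : EuclideanSpace ℝ (Fin n)) (s : ℝ), 0 < s ∧
        1 ≤ HeatMean.heatKernel (HeatMean.pair (0 : EuclideanSpace ℝ (Fin m)) y) s ∧
        k = HeatMean.modKernel m n y s}
      (HeatMean.modConst m n) ∧
    ∀ (Ω : Set (EuclideanSpace ℝ (Fin n) × ℝ)) (u : EuclideanSpace ℝ (Fin n) × ℝ → ℝ),
      IsOpen Ω → ContDiffOn ℝ 2 u Ω → (∀ p ∈ Ω, 0 ≤ HeatMean.heatOp u p) →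
      ∀ (x : EuclideanSpace ℝ (Fin n)) (t R : ℝ), 0 < R → HeatMean.modHeatBall m x t R ⊆ Ω →
        IntegrableOn (fun p => max (u p) 0) (HeatMean.modHeatBall m x t R) ∧
        max (u (x, t)) 0 ≤ HeatMean.modConst m n / R ^ (n + 2) *
          ∫ p in HeatMean.modHeatBall m x t R, max (u p) 0 := by
  refine ⟨HeatMean.isGreatest_modKernel hm, fun Ω u hΩ hu hH x t R hR hE => ⟨?_, max_le ?_ ?_⟩⟩
  · exact ((hu.continuousOn.mono hE).sup continuousOn_const).integrableOn_compact
      (HeatMean.isCompact_modHeatBall (by omega) x t hR)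
  · exact HeatMean.le_integral_modHeatBall hm hΩ hu hH x t hR hE
  · exact mul_nonneg (div_nonneg (HeatMean.modConst_nonneg hm) (by positivity))
      (integral_nonneg fun p => le_max_right _ _)
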